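/- Let $\mathcal{F}u(\xi)=\widehat{u}(\xi)=(2\pi)^{-1/2}\int_{\mathbb{R}}u(x)e^{-i\xi x}\,dx$ denote the unitary Fourier transform, extended to $L^2(\mathbb{R})$, and for $f\in L^2(\mathbb{R})$ put $f^\bullet=\mathcal{F}^{-1}|\mathcal{F}f|$. Let $p:\mathbb{R}\to\mathbb{R}$ be continuous with $$A|\xi|^{2s}+c\le p(\xi)\le B|\xi|^{2s}\qquad\text{for all }\xi\in\mathbb{R},$$ for some constants $s\ge\tfrac12$, $A>0$, $B>0$ and $c\in\mathbb{R}$. Let $v\in\mathbb{R}$, where $|v|<A$ if $s=\tfrac12$, let $\omega>-\Sigma_v$ with $\Sigma_v=\inf_{\xi\in\mathbb{R}}(p(\xi)-v\xi)$, and let $\sigma\ge1$ be an integer. A boosted ground state is a minimizer $Q\in H^s(\mathbb{R})\setminus\{0\}$ of the functional $$\mathcal{J}(u)=\frac{\Big(\int_{\mathbb{R}}(p(\xi)-v\xi+\omega)|\widehat{u}(\xi)|^2\,d\xi\Big)^{\sigma+1}}{\|u\|_{L^{2\sigma+2}}^{2\sigma+2}}$$ over $u\in H^s(\mathbb{R})\setminus\{0\}$.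 Then for every boosted ground state $Q$ there are constants $\alpha,x_0\in\mathbb{R}$ such that $$Q(x)=e^{i\alpha}Q^\bullet(x+x_0)\qquad\text{for a.e. }x\in\mathbb{R}.$$ In particular, the function $\widetilde{Q}(x)=e^{-i\alpha}Q(x-x_0)$, which is $Q$ up to phase and translation, has a nonnegative Fourier transform (almost everywhere) and satisfies the conjugation symmetry $\widetilde{Q}(x)=\overline{\widetilde{Q}(-x)}$ for a.e. $x\in\mathbb{R}$. -/

import Mathlib

open MeasureTheory FourierTransform

namespace BoostedNLS

/-- Complex-valued functions in `L²(ℝ)` (up to equality almost everywhere). -/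
abbrev L2 : Type := Lp ℂ 2 (volume : Measure ℝ)

/-- The unitary Fourier transform on `L²(ℝ)` with the normalization
`û(ξ) = (2π)^(-1/2) ∫ u(x) e^(-i ξ x) dx`.  Mathlib's transform `𝓕` on `L²` is the extension by
density of `η ↦ ∫ u(x) e^(-2π i η x) dx`, so that `û(ξ) = (2π)^(-1/2) (𝓕 u)(ξ / (2π))`. -/
noncomputable def fourierHat (u : L2) (ξ : ℝ) : ℂ :=
  (((Real.sqrt (2 * Real.pi))⁻¹ : ℝ) : ℂ) * (𝓕 u : L2) (ξ / (2 * Real.pi))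

/-- The modulus `|g|` of `g ∈ L²(ℝ)`, as an element of `L²(ℝ)` with values in `ℂ`. -/
noncomputable def absL2 (g : L2) : L2 :=
  MemLp.toLp (fun x : ℝ => ((‖g x‖ : ℝ) : ℂ)) (Lp.memLp g).norm.ofReal

/-- The operation `u^• = F⁻¹ |F u|` on `L²(ℝ)`.  It does not depend on the normalization of the
Fourier transform, since the unitary dilation that relates two normalizations commutes with the
modulus; see `fourierHat_bullet`. -/
noncomputable def bullet (u : L2) : L2 := 𝓕⁻ (absL2 (𝓕 u))

theorem fourierHat_bullet (u : L2) :
    ∀ᵐ ξ : ℝ, fourierHat (bullet u) ξ = ((‖fourierHat u ξ‖ : ℝ) : ℂ) := by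
  have h1 : ∀ᵐ η : ℝ, (absL2 (𝓕 u)) η = ((‖(𝓕 u : L2) η‖ : ℝ) : ℂ) :=
    MemLp.coeFn_toLp (Lp.memLp (𝓕 u : L2)).norm.ofReal
  have h2 : Measure.QuasiMeasurePreserving (fun ξ : ℝ => ξ / (2 * Real.pi)) volume volume := by
    refine ⟨by fun_prop, ?_⟩
    have := Real.map_volume_mul_right (a := (2 * Real.pi)⁻¹) (by positivity)
    simp only [div_eq_mul_inv]
    rw [this]
    exact Measure.smul_absolutelyContinuous
  filter_upwards [h2.ae h1] with ξ hξ
  have h3 : (𝓕 (bullet u) : L2) = absL2 (𝓕 u) := fourier_fourierInv_eq _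
  unfold fourierHat
  rw [h3, hξ, norm_mul, Complex.norm_real, Real.norm_of_nonneg (by positivity)]
  push_cast
  ring

/-- The `L²` function `x ↦ e^(i θ) u(x + y)`. -/
noncomputable def phaseTranslate (θ y : ℝ) (u : L2) : L2 :=
  Complex.exp (θ * Complex.I) •
    Lp.compMeasurePreserving (fun x : ℝ => x + y) (measurePreserving_add_right volume y) u

/-- `u ∈ H^s(ℝ)`. -/
def MemHs (s : ℝ) (u : L2) : Prop :=
  TemperedDistribution.MemSobolev s 2 (Lp.toTemperedDistribution u)

/-- The bounds on the symbol: `p` is continuous and `A |ξ|^(2s) + c ≤ p(ξ) ≤ B |ξ|^(2s)` on `ℝ`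
with some constants `B > 0` and `c ∈ ℝ`, where `s ≥ 1/2` and `A > 0`. -/
def SymbolAssumption (p : ℝ → ℝ) (s A : ℝ) : Prop :=
  Continuous p ∧ 1 / 2 ≤ s ∧ 0 < A ∧
    ∃ B c : ℝ, 0 < B ∧ ∀ ξ : ℝ, A * |ξ| ^ (2 * s) + c ≤ p ξ ∧ p ξ ≤ B * |ξ| ^ (2 * s)

/-- `Σ_v = inf_ξ (p(ξ) - v ξ)`. -/
noncomputable def symbolInf (p : ℝ → ℝ) (v : ℝ) : ℝ := ⨅ ξ : ℝ, (p ξ - v * ξ)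

/-- The quadratic form `⟨u, (P(D) + i v ∂ₓ + ω) u⟩ = ∫ (p(ξ) - v ξ + ω) |û(ξ)|² dξ`. -/
noncomputable def energyForm (p : ℝ → ℝ) (v ω : ℝ) (u : L2) : ℝ :=
  ∫ ξ : ℝ, (p ξ - v * ξ + ω) * ‖fourierHat u ξ‖ ^ 2

/-- The Weinstein-type functional
`J(u) = ⟨u, (P(D) + i v ∂ₓ + ω) u⟩^(σ+1) / ‖u‖_{L^(2σ+2)}^(2σ+2)`, for integer `σ`. -/
noncomputable def weinstein (p : ℝ → ℝ) (v ω : ℝ) (σ : ℕ) (u : L2) : ℝ :=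
  energyForm p v ω u ^ (σ + 1) / ∫ x : ℝ, ‖u x‖ ^ (2 * σ + 2)

/-- Boosted ground states: the minimizers of `J` over `H^s(ℝ) \ {0}`. -/
def IsBoostedGroundState (p : ℝ → ℝ) (s v ω : ℝ) (σ : ℕ) (Q : L2) : Prop :=
  MemHs s Q ∧ Q ≠ 0 ∧ IsMinOn (weinstein p v ω σ) {u : L2 | MemHs s u ∧ u ≠ 0} Q

end BoostedNLS

namespace BoostedNLS

open scoped SchwartzMap ENNReal Convolution Pointwise

/-! Since `2σ + 2` is even, the `L^(2σ+2)` norm of `u` to that power is `‖u^(σ+1)‖²` in `L²`, that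
is, up to normalization, the squared norm of the `(σ+1)`-fold convolution of `û` with itself.
Replacing `û` by `|û|` leaves the energy unchanged and can only increase this norm. Minimality of
`Q` therefore forces equality in `|Q̂ * ⋯ * Q̂| ≤ |Q̂| * ⋯ * |Q̂|`
(`IsBoostedGroundState.integral_norm_pow_eq`, `exists_pow_L2_specAbs_eq`).

To extract the phase one needs `Q̂ ≠ 0` almost everywhere (`IsBoostedGroundState.specAbs_ne_zero`).
Perturb `Q^•` by `ε` times a function whose transform is the indicator of a bounded set where `Q̂`
vanishes. The energy changes only by a multiple of `ε²`, while the norm term grows linearly in `ε`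
unless a certain convolution integral is zero. Its vanishing makes the zero set of `Q̂` invariant,
up to null sets, under differences of points of a set of positive measure. By Steinhaus these
differences generate all of `ℝ`, so the zero set is null (`ae_mem_of_ae_translate`).

Given this, equality descends from the `(σ+1)`-fold to the 2-fold convolution. Equality in the
triangle inequality then says that the phase `θ` of `Q̂` satisfies `θ(η) θ(ξ - η) = Θ(ξ)` almost
everywhere. Measurable solutions are `e^(ia) e^(ibξ)` (`exists_exp_of_ae_mul_eq`), which is a
constant phase together with a translation.

Analytically, `H^(1/2)` does not give an integrable transform, so the convolution powers are
controlled in weighted `L²` spaces (`lintegral_weight_convPow_sq_lt_top`). -/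

/-! ### The Fourier transform on `L²`: duality, translation, conjugation. -/

theorem toLp_fourier_ae (f : 𝓢(ℝ, ℂ)) :
    (𝓕 (f.toLp 2 : L2) : L2) =ᵐ[volume] 𝓕 (f : ℝ → ℂ) := by
  rw [SchwartzMap.toLp_fourier_eq]
  exact SchwartzMap.coeFn_toLp _ _ _

theorem integral_mul_fourierInv (ψ : 𝓢(ℝ, ℂ)) (g : L2) :
    ∫ x, ψ x * (𝓕⁻ g : L2) x = ∫ x, (𝓕⁻ ψ) x * g x := by
  have h := congrArg (fun T => T ψ) (Lp.fourierInv_toTemperedDistribution_eq g)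
  simp only [TemperedDistribution.fourierInv_apply, Lp.toTemperedDistribution_apply,
    smul_eq_mul] at h
  exact h.symm

theorem integral_fourier_mul_of_integrable (χ : 𝓢(ℝ, ℂ)) {h : ℝ → ℂ} (hh : Integrable h) :
    ∫ x, (𝓕 χ) x * h x = ∫ x, χ x * 𝓕 h x := by
  have := VectorFourier.integral_fourierIntegral_smul_eq_flip (μ := volume) (ν := volume)
    (L := innerₗ ℝ) Real.continuous_fourierChar (by fun_prop) χ.integrable hh
  simpa [flip_innerₗ, SchwartzMap.fourier_coe, Real.fourier_eq, VectorFourier.fourierIntegral]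
    using this

/-- An integrable function whose Fourier integral is square integrable is the inverse `L²` Fourier
transform of that integral. -/
theorem ae_eq_fourierInv_of_fourier_ae_eq {h : ℝ → ℂ} (hh : Integrable h) {g : L2}
    (hg : 𝓕 h =ᵐ[volume] g) : h =ᵐ[volume] (𝓕⁻ g : L2) := by
  refine ae_eq_of_integral_contDiff_smul_eq hh.locallyIntegrable
    ((Lp.memLp (𝓕⁻ g : L2)).locallyIntegrable (by norm_num)) fun φ hφ hc => ?_
  have h1 : HasCompactSupport (Complex.ofRealCLM ∘ φ) := hc.comp_left rfl
  have h2 : ContDiff ℝ (⊤ : ℕ∞) (Complex.ofRealCLM ∘ φ) := by fun_prop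
  set ψ : 𝓢(ℝ, ℂ) := h1.toSchwartzMap h2
  have hψ : ∀ x, ψ x = (φ x : ℂ) := fun x => rfl
  simp only [Complex.real_smul, ← hψ]
  rw [integral_mul_fourierInv]
  have := integral_fourier_mul_of_integrable (𝓕⁻ ψ) hh
  rw [fourier_fourierInv_eq] at this
  rw [this]
  refine integral_congr_ae ?_
  filter_upwards [hg] with x hx
  rw [hx]

theorem fourier_eq_of_fourier_ae_eq {h g : L2} (hh : Integrable h)
    (hg : 𝓕 (h : ℝ → ℂ) =ᵐ[volume] g) : 𝓕 h = g := by
  have := ae_eq_fourierInv_of_fourier_ae_eq hh hg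
  have h2 : h = 𝓕⁻ g := Lp.ext this
  rw [h2, fourier_fourierInv_eq]

/-- Schwartz functions are dense in `L²`; on them the Fourier identities below become computations
with integrals. -/
theorem L2.induction_schwartz {P : L2 → Prop} (hc : IsClosed {u | P u})
    (h : ∀ f : 𝓢(ℝ, ℂ), P (f.toLp 2)) (u : L2) : P u :=
  DenseRange.induction_on (p := P)
    (SchwartzMap.denseRange_toLpCLM (p := 2) (E := ℝ) (F := ℂ) ENNReal.ofNat_ne_top) u hc h

/-- The translation `u ↦ u (· + y)` on `L²`. -/
noncomputable def translate (y : ℝ) (u : L2) : L2 :=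
  Lp.compMeasurePreserving (fun x : ℝ => x + y) (measurePreserving_add_right volume y) u

theorem translate_ae (y : ℝ) (u : L2) : translate y u =ᵐ[volume] fun x => u (x + y) :=
  Lp.coeFn_compMeasurePreserving u (measurePreserving_add_right volume y)

theorem memLp_character (y : ℝ) :
    MemLp (fun η : ℝ => Complex.exp (2 * Real.pi * (y * η) * Complex.I)) ∞ volume := by
  refine memLp_top_of_bound (by fun_prop) 1 (Filter.Eventually.of_forall fun η => ?_)
  rw [show (2 * Real.pi * (y * η) * Complex.I : ℂ) =
    ((2 * Real.pi * (y * η) : ℝ) : ℂ) * Complex.I by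
    push_cast; ring, Complex.norm_exp_ofReal_mul_I]

theorem fourier_translate (y : ℝ) (u : L2) :
    (𝓕 (translate y u) : L2) =ᵐ[volume]
      fun η => Complex.exp (2 * Real.pi * (y * η) * Complex.I) * (𝓕 u : L2) η := by
  suffices h : 𝓕 (translate y u) = (memLp_character y).toLp _ • (𝓕 u : L2) by
    rw [h]
    filter_upwards [Lp.coeFn_lpSMul (r := 2) ((memLp_character y).toLp _) (𝓕 u : L2),
      (memLp_character y).coeFn_toLp] with x h1 h2
    rw [h1, Pi.smul_apply', h2, smul_eq_mul]
  refine L2.induction_schwartz (P := fun u => 𝓕 (translate y u) =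
    (memLp_character y).toLp _ • (𝓕 u : L2)) ?_ ?_ u
  · refine isClosed_eq ?_ ?_
    · exact (Lp.fourierTransformₗᵢ ℝ ℂ).continuous.comp
        (Lp.isometry_compMeasurePreserving _).continuous
    · have h1 : Continuous fun u : L2 => (memLp_character y).toLp _ • u := by
        refine AddMonoidHomClass.continuous_of_bound
          (AddMonoidHom.mk' (fun u : L2 => (memLp_character y).toLp _ • u)
            fun a b => Lp.add_smul _ a b)
          ‖(memLp_character y).toLp _‖ fun u => Lp.norm_smul_le _ _
      exact h1.comp (Lp.fourierTransformₗᵢ ℝ ℂ).continuous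
  · intro f
    have ht : translate y (f.toLp 2) =ᵐ[volume] fun x => f (x + y) := by
      refine (translate_ae y _).trans ?_
      exact (measurePreserving_add_right volume y).quasiMeasurePreserving.ae_eq_comp
        (SchwartzMap.coeFn_toLp f 2 volume)
    refine fourier_eq_of_fourier_ae_eq ((f.integrable.comp_add_right y).congr ht.symm) ?_
    filter_upwards [Lp.coeFn_lpSMul (r := 2) ((memLp_character y).toLp _) (𝓕 (f.toLp 2 : L2) : L2),
      (memLp_character y).coeFn_toLp, toLp_fourier_ae f] with η h1 h2 h3
    rw [h1, Pi.smul_apply', h2, h3, smul_eq_mul, Real.fourier_congr_ae ht]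
    have := congrFun (VectorFourier.fourierIntegral_comp_add_right Real.fourierChar volume
      (innerₗ ℝ) f y) η
    refine this.trans ?_
    rw [Circle.smul_def, Real.fourierChar_apply, smul_eq_mul]
    congr 2
    simp; ring

/-- The conjugate reflection `u ↦ conj (u (-·))` on `L²`. -/
noncomputable def conjNeg (u : L2) : L2 :=
  star (Lp.compMeasurePreserving (fun x : ℝ => -x) (Measure.measurePreserving_neg volume) u)

theorem conjNeg_ae (u : L2) : conjNeg u =ᵐ[volume] fun x => star (u (-x)) := by
  filter_upwards [Lp.coeFn_star (Lp.compMeasurePreserving (fun x : ℝ => -x)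
    (Measure.measurePreserving_neg volume) u),
    Lp.coeFn_compMeasurePreserving u (Measure.measurePreserving_neg volume)] with x h1 h2
  rw [conjNeg, h1, Pi.star_apply, h2]; rfl

theorem fourier_conjNeg (u : L2) : 𝓕 (conjNeg u) = star (𝓕 u : L2) := by
  have hstar : Continuous (star : L2 → L2) := by
    have h : (star : L2 → L2) =
        (Complex.conjCLE : ℂ →L[ℝ] ℂ).compLpL 2 (volume : Measure ℝ) := by
      funext u
      refine Lp.ext ?_
      filter_upwards [Lp.coeFn_star u,
        ContinuousLinearMap.coeFn_compLpL (p := 2) (μ := (volume : Measure ℝ))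
          (Complex.conjCLE : ℂ →L[ℝ] ℂ) u] with x h1 h2
      rw [h1, h2]; rfl
    rw [h]
    exact ContinuousLinearMap.continuous _
  refine L2.induction_schwartz (P := fun u => 𝓕 (conjNeg u) = star (𝓕 u : L2)) ?_ ?_ u
  · refine isClosed_eq ?_ ?_
    · exact (Lp.fourierTransformₗᵢ ℝ ℂ).continuous.comp
        (hstar.comp (Lp.isometry_compMeasurePreserving _).continuous)
    · exact hstar.comp (Lp.fourierTransformₗᵢ ℝ ℂ).continuous
  · intro f
    have ht : conjNeg (f.toLp 2) =ᵐ[volume] fun x => star (f (-x)) := by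
      refine (conjNeg_ae _).trans ?_
      filter_upwards [(Measure.measurePreserving_neg volume).quasiMeasurePreserving.ae_eq_comp
        (SchwartzMap.coeFn_toLp f 2 volume)] with x hx
      exact congrArg star hx
    have hi : Integrable (fun x => star (f (-x))) := by
      exact (Complex.conjLIE.integrable_comp_iff).2 f.integrable.comp_neg
    refine fourier_eq_of_fourier_ae_eq (hi.congr ht.symm) ?_
    filter_upwards [Lp.coeFn_star (𝓕 (f.toLp 2 : L2) : L2), toLp_fourier_ae f] with η h1 h2
    rw [h1, Pi.star_apply, h2, Real.fourier_congr_ae ht,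
      Real.fourier_real_eq_integral_exp_smul, Real.fourier_real_eq_integral_exp_smul]
    rw [← integral_neg_eq_self]
    simp only [smul_eq_mul, Complex.star_def]
    rw [← integral_conj]
    congr 1; ext v
    rw [map_mul, ← Complex.exp_conj]
    simp [Complex.conj_ofNat]

/-! ### Products in `L²` and convolutions of transforms. -/

theorem quasi_sub (ξ : ℝ) : Measure.QuasiMeasurePreserving (fun η : ℝ => ξ - η) volume volume :=
  (Measure.measurePreserving_sub_left volume ξ).quasiMeasurePreserving

theorem memLp_sub_left (ξ : ℝ) (u : L2) : MemLp (fun η : ℝ => u (ξ - η)) 2 volume :=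
  (Lp.memLp u).comp_measurePreserving (Measure.measurePreserving_sub_left volume ξ)

theorem integrable_mul_sub (ξ : ℝ) (u w : L2) : Integrable (fun η : ℝ => u η * w (ξ - η)) :=
  (Lp.memLp u).integrable_mul (memLp_sub_left ξ w)

theorem integral_mul_sub_comm (ξ : ℝ) (u w : L2) :
    ∫ η : ℝ, u η * w (ξ - η) = ∫ η : ℝ, w η * u (ξ - η) := by
  rw [← integral_sub_left_eq_self (fun η => w η * u (ξ - η)) volume ξ]
  congr 1; ext η; simp [mul_comm]

theorem continuous_integral_mul {w : ℝ → ℂ} (hw : MemLp w 2 volume) :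
    Continuous fun u : L2 => ∫ η : ℝ, u η * w η := by
  have h : (fun u : L2 => ∫ η : ℝ, u η * w η) = fun u => inner ℂ (hw.star.toLp (star w)) u := by
    funext u
    rw [L2.inner_def]
    refine integral_congr_ae ?_
    filter_upwards [hw.star.coeFn_toLp] with x hx
    rw [hx]
    simp [mul_comm]
  rw [h]
  fun_prop

/-- The rule "transform of a convolution is a product" is applied to `𝓕 f` and `𝓕 g` and then
inverted, using that `𝓕⁻` is `𝓕` followed by reflection. -/
theorem integral_conv_schwartz (f g : 𝓢(ℝ, ℂ)) (ξ : ℝ) :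
    𝓕 (fun x => f x * g x) ξ = ∫ η : ℝ, (𝓕 f) η * (𝓕 g) (ξ - η) := by
  set B := ContinuousLinearMap.mul ℂ ℂ
  have hF : ∀ (h : 𝓢(ℝ, ℂ)) (x : ℝ), (𝓕⁻ h) x = (𝓕 h) (-x) := fun h x => by
    rw [SchwartzMap.fourierInv_coe, SchwartzMap.fourier_coe, Real.fourierInv_eq_fourier_neg]
  have h1 : 𝓕⁻ (SchwartzMap.convolution B (𝓕 f) (𝓕 g)) = SchwartzMap.pairing B f g := by
    ext x
    rw [hF, SchwartzMap.fourier_convolution, SchwartzMap.pairing_apply_apply,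
      SchwartzMap.pairing_apply_apply, ← hF, ← hF, fourierInv_fourier_eq, fourierInv_fourier_eq]
  have h2 : SchwartzMap.convolution B (𝓕 f) (𝓕 g) = 𝓕 (SchwartzMap.pairing B f g) := by
    rw [← h1, fourier_fourierInv_eq]
  have h3 := SchwartzMap.convolution_apply B (𝓕 f) (𝓕 g) ξ
  rw [h2, SchwartzMap.fourier_coe] at h3
  exact h3

/-- The Fourier integral of a product of `L²` functions is the convolution of their
transforms. -/
theorem fourier_mul (u w : L2) (ξ : ℝ) :
    𝓕 (fun x => u x * w x) ξ = ∫ η : ℝ, (𝓕 u : L2) η * (𝓕 w : L2) (ξ - η) := by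
  have key : ∀ w : L2, IsClosed {u : L2 |
      𝓕 (fun x => u x * w x) ξ = ∫ η : ℝ, (𝓕 u : L2) η * (𝓕 w : L2) (ξ - η)} := by
    intro w
    refine isClosed_eq ?_ ?_
    · have hm : MemLp (fun x : ℝ => Complex.exp (2 * Real.pi * (-ξ * x) * Complex.I) * w x) 2
          volume := by
        have := memLp_character (-ξ)
        push_cast at this
        exact (Lp.memLp w).mul' this
      convert continuous_integral_mul hm using 2 with u
      rw [Real.fourier_real_eq_integral_exp_smul]
      congr 1; ext x
      simp only [smul_eq_mul]
      push_cast
      rw [show (-2 * Real.pi * x * ξ * Complex.I : ℂ) = 2 * Real.pi * (-ξ * x) * Complex.I by ring]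
      ring
    · exact (continuous_integral_mul (memLp_sub_left ξ (𝓕 w))).comp
        (Lp.fourierTransformₗᵢ ℝ ℂ).continuous
  have base : ∀ f g : 𝓢(ℝ, ℂ), 𝓕 (fun x => (f.toLp 2 : L2) x * (g.toLp 2 : L2) x) ξ =
      ∫ η : ℝ, (𝓕 (f.toLp 2 : L2) : L2) η * (𝓕 (g.toLp 2 : L2) : L2) (ξ - η) := by
    intro f g
    have h1 : (fun x => (f.toLp 2 : L2) x * (g.toLp 2 : L2) x) =ᵐ[volume]
        fun x => f x * g x := by
      filter_upwards [SchwartzMap.coeFn_toLp f 2 volume, SchwartzMap.coeFn_toLp g 2 volume]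
        with x h h'
      rw [h, h']
    rw [Real.fourier_congr_ae h1, integral_conv_schwartz]
    refine integral_congr_ae ?_
    filter_upwards [toLp_fourier_ae f, (quasi_sub ξ).ae_eq_comp (toLp_fourier_ae g)] with η h h'
    simp only [Function.comp_apply] at h'
    rw [h, h']; rfl
  obtain ⟨P, hP⟩ : ∃ P : L2 → L2 → Prop, ∀ u w, P u w ↔ 𝓕 (fun x => u x * w x) ξ =
      ∫ η : ℝ, (𝓕 u : L2) η * (𝓕 w : L2) (ξ - η) := ⟨_, fun _ _ => Iff.rfl⟩
  simp only [← hP] at base key ⊢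
  -- Closedness was shown in the first argument only; the symmetry of the identity allows a density
  -- argument in each argument in turn.
  have symm : ∀ u w, P u w → P w u := by
    intro u w h
    rw [hP, integral_mul_sub_comm] at h
    rw [hP, ← h]
    simp only [mul_comm]
  refine L2.induction_schwartz (key w) (fun f => symm _ _ ?_) u
  exact L2.induction_schwartz (key _) (fun g => base g f) w

/-- If the convolution of the transforms of `u, w ∈ L²` is square integrable, then it is the
transform of `u w`, which is therefore square integrable. -/
theorem mul_ae_eq_fourierInv (u w g : L2)
    (hg : (g : ℝ → ℂ) =ᵐ[volume] fun ξ => ∫ η : ℝ, (𝓕 u : L2) η * (𝓕 w : L2) (ξ - η)) :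
    (fun x => u x * w x) =ᵐ[volume] (𝓕⁻ g : L2) := by
  refine ae_eq_fourierInv_of_fourier_ae_eq ((Lp.memLp u).integrable_mul (Lp.memLp w)) ?_
  filter_upwards [hg] with ξ h
  rw [h]
  exact fourier_mul u w ξ

/-! ### Sobolev membership as a weighted integrability condition on the transform. -/

theorem memHs_iff_memLp {s : ℝ} {u : L2} :
    MemHs s u ↔
      MemLp (fun η : ℝ => (((1 + ‖η‖ ^ 2) ^ (s / 2) : ℝ) : ℂ) * (𝓕 u : L2) η) 2 volume := by
  have hg : (fun η : ℝ => (((1 + ‖η‖ ^ 2) ^ (s / 2) : ℝ) : ℂ)).HasTemperateGrowth := by fun_prop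
  have hgc : Continuous (fun η : ℝ => (((1 + ‖η‖ ^ 2) ^ (s / 2) : ℝ) : ℂ)) := hg.1.continuous
  have hT : ∀ ψ : 𝓢(ℝ, ℂ), TemperedDistribution.smulLeftCLM ℂ
      (fun η : ℝ => (((1 + ‖η‖ ^ 2) ^ (s / 2) : ℝ) : ℂ))
      (𝓕 (Lp.toTemperedDistribution u)) ψ =
      ∫ η : ℝ, ψ η * ((((1 + ‖η‖ ^ 2) ^ (s / 2) : ℝ) : ℂ) * (𝓕 u : L2) η) := by
    intro ψ
    rw [TemperedDistribution.smulLeftCLM_apply_apply, Lp.fourier_toTemperedDistribution_eq,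
      Lp.toTemperedDistribution_apply]
    congr 1; ext η
    rw [SchwartzMap.smulLeftCLM_apply_apply hg, smul_eq_mul, smul_eq_mul]
    ring
  unfold MemHs
  rw [TemperedDistribution.memSobolev_iff_exists_smulLeftCLM_fourier]
  constructor
  · rintro ⟨f', hf'⟩
    have h : (fun η : ℝ => (((1 + ‖η‖ ^ 2) ^ (s / 2) : ℝ) : ℂ) * (𝓕 u : L2) η) =ᵐ[volume] f' := by
      refine ae_eq_of_integral_contDiff_smul_eq ?_
        ((Lp.memLp f').locallyIntegrable (by norm_num)) fun φ hφ hc => ?_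
      · exact ((Lp.memLp (𝓕 u : L2)).locallyIntegrable (by norm_num)).continuous_mul hgc
      have h1 : HasCompactSupport (Complex.ofRealCLM ∘ φ) := hc.comp_left rfl
      have h2 : ContDiff ℝ (⊤ : ℕ∞) (Complex.ofRealCLM ∘ φ) := by fun_prop
      have h3 := hT (h1.toSchwartzMap h2)
      rw [hf', Lp.toTemperedDistribution_apply] at h3
      exact h3.symm
    exact (memLp_congr_ae h).2 (Lp.memLp f')
  · intro h
    refine ⟨h.toLp _, ?_⟩
    ext ψ
    rw [hT, Lp.toTemperedDistribution_apply]
    refine integral_congr_ae ?_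
    filter_upwards [h.coeFn_toLp] with η hη
    rw [hη, smul_eq_mul]

theorem memHs_iff {s : ℝ} {u : L2} :
    MemHs s u ↔ Integrable (fun η : ℝ => (1 + η ^ 2) ^ s * ‖(𝓕 u : L2) η‖ ^ 2) := by
  rw [memHs_iff_memLp, memLp_two_iff_integrable_sq_norm]
  · refine integrable_congr (Filter.Eventually.of_forall fun η => ?_)
    simp only [norm_mul, Complex.norm_real, mul_pow, Real.norm_eq_abs, sq_abs]
    rw [← Real.rpow_mul_natCast (by positivity)]
    norm_num
  · refine AEStronglyMeasurable.mul ?_ (Lp.aestronglyMeasurable _)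
    have : Continuous (fun η : ℝ => (1 + ‖η‖ ^ 2) ^ (s / 2)) :=
      Continuous.rpow_const (by fun_prop) fun x => Or.inl (by positivity)
    exact (Complex.continuous_ofReal.comp this).aestronglyMeasurable

/-! ### Convolution powers in weighted `L²` spaces. -/

/-- The weight `(1 + |x|)^γ`. -/
noncomputable def weight (γ x : ℝ) : ℝ≥0∞ := ENNReal.ofReal ((1 + |x|) ^ γ)

theorem measurable_weight (γ : ℝ) : Measurable (weight γ) := by
  unfold weight; fun_prop

theorem weight_mul (a b x : ℝ) : weight a x * weight b x = weight (a + b) x := by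
  unfold weight
  rw [← ENNReal.ofReal_mul (by positivity), ← Real.rpow_add (by positivity)]

theorem weight_zero (x : ℝ) : weight 0 x = 1 := by simp [weight]

theorem weight_mono {a b : ℝ} (h : a ≤ b) (x : ℝ) : weight a x ≤ weight b x :=
  ENNReal.ofReal_le_ofReal (Real.rpow_le_rpow_of_exponent_le (by simp) h)

theorem lintegral_weight_lt_top {δ : ℝ} (h : 1 < δ) : ∫⁻ x, weight (-δ) x < ∞ := by
  have := (integrable_one_add_norm (E := ℝ) (μ := volume) (r := δ) (by simpa using h))
  exact this.lintegral_lt_top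

/-- The larger of `|x|, |y|` is at least `|x + y| / 2`, so `γ` of its decay controls decay in `x +
y`; its remaining decay is at least that of the smaller variable, where it is collected. -/
theorem weight_mul_weight_le {α β γ : ℝ} (h0 : 0 ≤ γ) (hα : γ ≤ α) (hβ : γ ≤ β) (x y : ℝ) :
    weight (-α) x * weight (-β) y ≤ ENNReal.ofReal (2 ^ γ) * weight (-γ) (x + y) *
      (weight (-(α + β - γ)) x + weight (-(α + β - γ)) y) := by
  wlog hxy : |x| ≤ |y| generalizing x y α β
  · have := this hβ hα y x (not_le.1 hxy).le
    rw [mul_comm, add_comm x y, add_comm (weight _ x), add_comm α β]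
    exact this
  have h1 : weight (-α) x * weight (-β) y ≤
      ENNReal.ofReal (2 ^ γ) * weight (-γ) (x + y) * weight (-(α + β - γ)) x := by
    unfold weight
    rw [← ENNReal.ofReal_mul (by positivity), ← ENNReal.ofReal_mul (by positivity),
      ← ENNReal.ofReal_mul (by positivity)]
    refine ENNReal.ofReal_le_ofReal ?_
    have hx : 0 < 1 + |x| := by positivity
    have hy : 0 < 1 + |y| := by positivity
    have hs : 0 < 1 + |x + y| := by positivity
    have e1 : (1 + |y|) ^ (-β) ≤ (1 + |y|) ^ (-γ) * (1 + |x|) ^ (-(β - γ)) := by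
      have : (1 + |y|) ^ (-(β - γ)) ≤ (1 + |x|) ^ (-(β - γ)) :=
        Real.rpow_le_rpow_of_nonpos hx (by linarith) (by linarith)
      calc (1 + |y|) ^ (-β) = (1 + |y|) ^ (-γ) * (1 + |y|) ^ (-(β - γ)) := by
            rw [← Real.rpow_add hy]; ring_nf
        _ ≤ _ := by gcongr
    have e2 : (1 + |y|) ^ (-γ) ≤ 2 ^ γ * (1 + |x + y|) ^ (-γ) := by
      have : (2 * (1 + |y|)) ^ (-γ) ≤ (1 + |x + y|) ^ (-γ) :=
        Real.rpow_le_rpow_of_nonpos hs (by linarith [abs_add_le x y]) (by linarith)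
      rw [Real.mul_rpow (by norm_num) hy.le] at this
      calc (1 + |y|) ^ (-γ) = 2 ^ γ * (2 ^ (-γ) * (1 + |y|) ^ (-γ)) := by
            rw [← mul_assoc, ← Real.rpow_add (by norm_num)]; simp
        _ ≤ _ := by gcongr
    calc (1 + |x|) ^ (-α) * (1 + |y|) ^ (-β)
        ≤ (1 + |x|) ^ (-α) * ((2 ^ γ * (1 + |x + y|) ^ (-γ)) * (1 + |x|) ^ (-(β - γ))) := by
          gcongr
          exact e1.trans (by gcongr)
      _ = 2 ^ γ * (1 + |x + y|) ^ (-γ) * ((1 + |x|) ^ (-α) * (1 + |x|) ^ (-(β - γ))) := by ring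
      _ = _ := by rw [← Real.rpow_add hx]; ring_nf
  exact h1.trans (by gcongr; exact le_self_add)

theorem exists_lconvolution_weight_le {α β γ : ℝ} (h0 : 0 ≤ γ) (hα : γ ≤ α) (hβ : γ ≤ β)
    (h1 : 1 < α + β - γ) :
    ∃ C < ∞, ∀ ξ, ∫⁻ η, weight (-α) η * weight (-β) (-η + ξ) ≤ C * weight (-γ) ξ := by
  set I := ∫⁻ x, weight (-(α + β - γ)) x with hI
  have hIt : I < ∞ := lintegral_weight_lt_top h1
  refine ⟨ENNReal.ofReal (2 ^ γ) * (I + I), by finiteness, fun ξ => ?_⟩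
  have hm := measurable_weight (-(α + β - γ))
  calc ∫⁻ η, weight (-α) η * weight (-β) (-η + ξ)
      ≤ ∫⁻ η, ENNReal.ofReal (2 ^ γ) * weight (-γ) ξ *
        (weight (-(α + β - γ)) η + weight (-(α + β - γ)) (-η + ξ)) := by
        refine lintegral_mono fun η => ?_
        have := weight_mul_weight_le h0 hα hβ η (-η + ξ)
        rwa [add_neg_cancel_left] at this
    _ = ENNReal.ofReal (2 ^ γ) * weight (-γ) ξ * (I + I) := by
        rw [lintegral_const_mul _ (by fun_prop), lintegral_add_left hm]
        congr 2
        simp only [neg_add_eq_sub]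
        exact lintegral_sub_left_eq_self _ ξ
    _ = _ := by ring

theorem lintegral_mul_sq_le {f g : ℝ → ℝ≥0∞} (hf : Measurable f) (hg : Measurable g) :
    (∫⁻ x, f x * g x) ^ 2 ≤ (∫⁻ x, f x ^ 2) * ∫⁻ x, g x ^ 2 := by
  have := ENNReal.lintegral_mul_le_Lp_mul_Lq volume Real.HolderConjugate.two_two
    hf.aemeasurable hg.aemeasurable
  calc (∫⁻ x, f x * g x) ^ 2
      ≤ ((∫⁻ x, f x ^ (2:ℝ)) ^ (1 / (2:ℝ)) * (∫⁻ x, g x ^ (2:ℝ)) ^ (1 / (2:ℝ))) ^ 2 := by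
        gcongr; exact this
    _ = _ := by
        rw [mul_pow, ← ENNReal.rpow_mul_natCast, ← ENNReal.rpow_mul_natCast]
        simp

theorem lintegral_lconvolution {f g : ℝ → ℝ≥0∞} (hf : Measurable f) (hg : Measurable g) :
    ∫⁻ x, (f ⋆ₗ g) x = (∫⁻ x, f x) * ∫⁻ x, g x := by
  simp only [lconvolution_def]
  rw [lintegral_lintegral_swap (by fun_prop), ← lintegral_mul_const _ hf]
  refine lintegral_congr fun y => ?_
  rw [lintegral_const_mul _ (by fun_prop), lintegral_add_left_eq_self]

/-- The convolution of weighted `L²` functions is a weighted `L²` function. -/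
theorem lintegral_weight_lconvolution_sq_lt_top {α β γ : ℝ} (h0 : 0 ≤ γ) (hα : γ ≤ α) (hβ : γ ≤ β)
    (h1 : 1 < α + β - γ) {f g : ℝ → ℝ≥0∞} (hf : Measurable f) (hg : Measurable g)
    (hfα : ∫⁻ x, weight α x * f x ^ 2 < ∞) (hgβ : ∫⁻ x, weight β x * g x ^ 2 < ∞) :
    ∫⁻ x, weight γ x * (f ⋆ₗ g) x ^ 2 < ∞ := by
  obtain ⟨C, hC, hCle⟩ := exists_lconvolution_weight_le h0 hα hβ h1
  have mw := measurable_weight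
  have hsq : ∀ a x, weight (a / 2) x ^ 2 = weight a x := fun a x => by
    rw [sq, weight_mul]; ring_nf
  have hpt : ∀ ξ, (f ⋆ₗ g) ξ ^ 2 ≤
      ((fun x => weight α x * f x ^ 2) ⋆ₗ fun x => weight β x * g x ^ 2) ξ *
        (C * weight (-γ) ξ) := by
    intro ξ
    -- Inserting weights and their inverses prepares Cauchy–Schwarz: one factor is a convolution of
    -- integrable functions, the other is bounded by `exists_lconvolution_weight_le`.
    have e : (f ⋆ₗ g) ξ = ∫⁻ η, (weight (α / 2) η * f η * (weight (β / 2) (-η + ξ) * g (-η + ξ))) *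
        (weight (-α / 2) η * weight (-β / 2) (-η + ξ)) := by
      rw [lconvolution_def]
      refine lintegral_congr fun η => ?_
      calc f η * g (-η + ξ) = (weight (α / 2) η * weight (-α / 2) η) *
            (weight (β / 2) (-η + ξ) * weight (-β / 2) (-η + ξ)) * (f η * g (-η + ξ)) := by
            rw [weight_mul, weight_mul]; ring_nf; simp [weight_zero]
        _ = _ := by ring
    rw [e]
    refine (lintegral_mul_sq_le (by fun_prop) (by fun_prop)).trans ?_
    simp only [mul_pow, hsq]
    exact mul_le_mul' le_rfl (hCle ξ)
  calc ∫⁻ x, weight γ x * (f ⋆ₗ g) x ^ 2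
      ≤ ∫⁻ x, C * ((fun x => weight α x * f x ^ 2) ⋆ₗ fun x => weight β x * g x ^ 2) x := by
        refine lintegral_mono fun x => ?_
        calc weight γ x * (f ⋆ₗ g) x ^ 2 ≤ weight γ x * _ := mul_le_mul' le_rfl (hpt x)
          _ = C * ((fun x => weight α x * f x ^ 2) ⋆ₗ fun x => weight β x * g x ^ 2) x *
            (weight γ x * weight (-γ) x) := by ring
          _ = _ := by rw [weight_mul]; simp [weight_zero]
    _ = C * ((∫⁻ x, weight α x * f x ^ 2) * ∫⁻ x, weight β x * g x ^ 2) := by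
        rw [lintegral_const_mul _ (measurable_lconvolution _ (by fun_prop) (by fun_prop)),
          lintegral_lconvolution (by fun_prop) (by fun_prop)]
    _ < ∞ := by finiteness

/-- The `(n + 1)`-fold convolution `f * ⋯ * f`. -/
noncomputable def convPow (f : ℝ → ℝ≥0∞) : ℕ → ℝ → ℝ≥0∞
  | 0 => f
  | n + 1 => f ⋆ₗ convPow f n

theorem measurable_convPow {f : ℝ → ℝ≥0∞} (hf : Measurable f) (n : ℕ) :
    Measurable (convPow f n) := by
  induction n with
  | zero => exact hf
  | succ n ih => exact measurable_lconvolution _ hf ih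

/-- Weight exponent 1 is critical, and each convolution costs an arbitrarily small part of it; hence
the strict bound `γ < 1`, which leaves room for every further step. -/
theorem lintegral_weight_convPow_sq_lt_top {f : ℝ → ℝ≥0∞} (hf : Measurable f)
    (h : ∫⁻ x, weight 1 x * f x ^ 2 < ∞) (n : ℕ) {γ : ℝ} (h0 : 0 ≤ γ) (h1 : γ < 1) :
    ∫⁻ x, weight γ x * convPow f n x ^ 2 < ∞ := by
  induction n generalizing γ with
  | zero =>
    refine lt_of_le_of_lt (lintegral_mono fun x => ?_) h
    exact mul_le_mul' (weight_mono h1.le x) le_rfl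
  | succ n ih =>
    -- The midpoint `β` of `γ` and `1` is below the critical exponent and satisfies `1 < 1 + β - γ`.
    exact lintegral_weight_lconvolution_sq_lt_top (α := 1) (β := (1 + γ) / 2) h0 h1.le
      (by linarith) (by linarith) hf (measurable_convPow hf n) h (ih (by linarith) (by linarith))

theorem lintegral_convPow_sq_lt_top {f : ℝ → ℝ≥0∞} (hf : Measurable f)
    (h : ∫⁻ x, weight 1 x * f x ^ 2 < ∞) (n : ℕ) : ∫⁻ x, convPow f n x ^ 2 < ∞ := by
  simpa [weight_zero] using lintegral_weight_convPow_sq_lt_top hf h n le_rfl one_pos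

theorem lconvolution_mono {f f' g g' : ℝ → ℝ≥0∞} (hf : f ≤ f') (hg : g ≤ g') :
    f ⋆ₗ g ≤ f' ⋆ₗ g' :=
  fun _ => lintegral_mono fun _ => mul_le_mul' (hf _) (hg _)

theorem convPow_mono {f g : ℝ → ℝ≥0∞} (h : f ≤ g) (n : ℕ) : convPow f n ≤ convPow g n := by
  induction n with
  | zero => exact h
  | succ n ih => exact lconvolution_mono h ih

/-! ### Measurable solutions of the multiplicative Cauchy equation. -/

/-- A differentiable unimodular character of `ℝ` is an exponential. -/
theorem exists_exp_of_differentiable_character {χ : ℝ → ℂ} (hd : Differentiable ℝ χ)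
    (h1 : ∀ x, ‖χ x‖ = 1) (hadd : ∀ x y, χ (x + y) = χ x * χ y) :
    ∃ b : ℝ, ∀ x, χ x = Complex.exp (b * x * Complex.I) := by
  have h0 : χ 0 = 1 := by
    have := hadd 0 0
    have hne : χ 0 ≠ 0 := by rw [← norm_ne_zero_iff, h1]; norm_num
    simpa [hne] using this
  set l := deriv χ 0 with hl
  have hder : ∀ x, HasDerivAt χ (χ x * l) x := by
    intro x
    have h2 : HasDerivAt (fun t => χ (x + t)) (χ x * l) 0 := by
      simp only [hadd]
      exact ((hd 0).hasDerivAt).const_mul _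
    have h3 := HasDerivAt.comp_sub_const x x (f := fun t => χ (x + t)) (f' := χ x * l)
      (by simpa using h2)
    simpa using h3
  have hexp : ∀ x, χ x = Complex.exp (l * x) := by
    have hc : ∀ x : ℝ, HasDerivAt (fun x : ℝ => χ x * Complex.exp (-l * x)) 0 x := by
      intro x
      have e : HasDerivAt (fun x : ℝ => Complex.exp (-l * x)) (Complex.exp (-l * x) * (-l)) x := by
        have := ((Complex.ofRealCLM.hasDerivAt (x := x)).const_mul (-l)).cexp
        simpa using this
      exact ((hder x).mul e).congr_deriv (by ring)
    intro x
    have := is_const_of_deriv_eq_zero (fun y => (hc y).differentiableAt) (fun y => (hc y).deriv) x 0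
    simp only [h0, Complex.ofReal_zero, mul_zero, Complex.exp_zero, mul_one,
      neg_mul, Complex.exp_neg] at this
    field_simp at this
    exact this
  have hre : l.re = 0 := by
    have := h1 1
    rw [hexp, Complex.norm_exp] at this
    simpa using this
  refine ⟨l.im, fun x => ?_⟩
  rw [hexp]
  congr 1
  conv_lhs => rw [← Complex.re_add_im l, hre]
  push_cast; ring

/-- Measurable solutions of the almost everywhere functional equation `θ x * θ y = Θ (x + y)` with
values in the unit circle are exponentials. -/
theorem exists_exp_of_ae_mul_eq {θ Θ : ℝ → ℂ} (hθ : Measurable θ) (h1 : ∀ x, ‖θ x‖ = 1)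
    (h : ∀ᵐ x, ∀ᵐ y, θ x * θ y = Θ (x + y)) :
    ∃ a b : ℝ, ∀ᵐ x, θ x = Complex.exp (a * Complex.I) * Complex.exp (b * x * Complex.I) := by
  have hli : LocallyIntegrable θ volume := by
    have : MemLp θ ∞ volume :=
      memLp_top_of_bound hθ.aestronglyMeasurable 1 (Filter.Eventually.of_forall fun x => (h1 x).le)
    exact this.locallyIntegrable le_top
  have hne : ∀ x, θ x ≠ 0 := fun x => by rw [← norm_ne_zero_iff, h1]; norm_num
  obtain ⟨x₀, hx₀⟩ := h.exists
  -- A good base point `x₀` eliminates the unknown `Θ`.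
  have h2 : ∀ᵐ x, ∀ᵐ y, θ x * θ y = θ x₀ * θ (x + y - x₀) := by
    filter_upwards [h] with x hx
    have : ∀ᵐ y, θ x₀ * θ (x + y - x₀) = Θ (x₀ + (x + y - x₀)) := by
      have q : Measure.QuasiMeasurePreserving (fun y : ℝ => x + y - x₀) volume volume := by
        have := (measurePreserving_add_left volume (x - x₀)).quasiMeasurePreserving
        convert this using 2
        ring
      exact q.ae hx₀
    filter_upwards [hx, this] with y ha hb
    rw [ha, hb]; congr 1; ring
  obtain ⟨φ, hφ, hφc, hK⟩ : ∃ φ : ℝ → ℝ, ContDiff ℝ (⊤ : ℕ∞) φ ∧ HasCompactSupport φ ∧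
      ∫ y, φ y • θ y ≠ 0 := by
    by_contra! hcon
    have := ae_eq_zero_of_integral_contDiff_smul_eq_zero hli hcon
    obtain ⟨x, hx⟩ := this.exists
    exact hne x hx
  set K := ∫ y, φ y • θ y with hKdef
  set L := (ContinuousLinearMap.lsmul ℝ ℝ : ℝ →L[ℝ] ℂ →L[ℝ] ℂ).flip with hL
  have hφn : ContDiff ℝ (⊤ : ℕ∞) (fun t => φ (-t)) := hφ.comp contDiff_neg
  have hφcn : HasCompactSupport (fun t => φ (-t)) := hφc.comp_homeomorph (Homeomorph.neg ℝ)
  have hconv : ContDiff ℝ (⊤ : ℕ∞) (θ ⋆[L, volume] fun t => φ (-t)) :=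
    hφcn.contDiff_convolution_right L hli hφn
  -- Integrating the equation in `y` against `φ` gives `θ x * K = θ x₀ * ∫ φ(y) θ(x + y - x₀) dy`.
  -- The right side is a convolution with the reflected bump, so `θ` agrees almost everywhere with
  -- the smooth function `ψ`.
  set ψ : ℝ → ℂ := fun x => θ x₀ / K * (θ ⋆[L, volume] fun t => φ (-t)) (x - x₀) with hψ
  have hψd : ContDiff ℝ (⊤ : ℕ∞) ψ :=
    contDiff_const.mul (hconv.comp (contDiff_id.sub contDiff_const))
  have hψc := hψd.continuous
  have hae : ∀ᵐ x, θ x = ψ x := by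
    filter_upwards [h2] with x hx
    have e1 : θ x * K = θ x₀ * ∫ y, φ y • θ (x + y - x₀) := by
      rw [hKdef, ← integral_const_mul, ← integral_const_mul]
      refine integral_congr_ae ?_
      filter_upwards [hx] with y hy
      rw [mul_smul_comm, hy, mul_smul_comm]
    have e2 : ∫ y, φ y • θ (x + y - x₀) = (θ ⋆[L, volume] fun t => φ (-t)) (x - x₀) := by
      rw [convolution_def, ← integral_add_right_eq_self
        (fun z => L (θ z) (φ (-(x - x₀ - z)))) (x - x₀)]
      refine integral_congr_ae (Filter.Eventually.of_forall fun y => ?_)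
      simp only [hL, ContinuousLinearMap.flip_apply, ContinuousLinearMap.lsmul_apply]
      congr 2 <;> ring_nf
    rw [hψ]
    simp only
    rw [← e2, div_mul_eq_mul_div, ← e1, mul_div_cancel_right₀ _ hK]
  have hψ1 : ∀ x, ‖ψ x‖ = 1 := by
    have : (fun x => ‖ψ x‖) = fun _ => (1 : ℝ) := by
      refine Continuous.ae_eq_iff_eq volume hψc.norm continuous_const |>.1 ?_
      filter_upwards [hae] with x hx
      rw [← hx, h1]
    exact congrFun this
  have hψne : ∀ x, ψ x ≠ 0 := fun x => by rw [← norm_ne_zero_iff, hψ1]; norm_num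
  -- Continuity of `ψ` upgrades the identity from almost every to every point, one variable at a
  -- time.
  have hψm : ∀ x y, ψ x * ψ y = θ x₀ * ψ (x + y - x₀) := by
    have s1 : ∀ᵐ x, ∀ y, ψ x * ψ y = θ x₀ * ψ (x + y - x₀) := by
      filter_upwards [h2, hae] with x hx hx'
      have : (fun y => ψ x * ψ y) = fun y => θ x₀ * ψ (x + y - x₀) := by
        refine Continuous.ae_eq_iff_eq volume (by fun_prop) (by fun_prop) |>.1 ?_
        have q : Measure.QuasiMeasurePreserving (fun y : ℝ => x + y - x₀) volume volume := by
          have := (measurePreserving_add_left volume (x - x₀)).quasiMeasurePreserving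
          convert this using 2
          ring
        filter_upwards [hx, hae, q.ae hae] with y ha hb hc
        rw [← hx', ← hb, ← hc, ha]
      exact congrFun this
    intro x y
    have : (fun x => ψ x * ψ y) = fun x => θ x₀ * ψ (x + y - x₀) := by
      refine Continuous.ae_eq_iff_eq volume (by fun_prop) (by fun_prop) |>.1 ?_
      filter_upwards [s1] with x hx
      exact hx y
    exact congrFun this x
  have hψ0 : ψ x₀ = θ x₀ := by
    have := hψm x₀ x₀
    rw [add_sub_cancel_right] at this
    exact mul_right_cancel₀ (hψne x₀) this
  obtain ⟨b, hb⟩ := exists_exp_of_differentiable_character (χ := fun x => ψ (x + x₀) / θ x₀)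
    (by
      have : Differentiable ℝ ψ := hψd.differentiable (by simp)
      fun_prop)
    (fun x => by rw [norm_div, hψ1, h1, div_one])
    (fun x y => by
      have := hψm (x + x₀) (y + x₀)
      rw [show x + x₀ + (y + x₀) - x₀ = x + y + x₀ by ring] at this
      have h0 := hne x₀
      field_simp
      rw [this]; ring)
  have hc : ‖θ x₀ * Complex.exp (b * (-x₀ : ℝ) * Complex.I)‖ = 1 := by
    rw [norm_mul, h1, one_mul, ← Complex.ofReal_mul, Complex.norm_exp_ofReal_mul_I]
  obtain ⟨a, ha⟩ := (Complex.norm_eq_one_iff _).1 hc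
  refine ⟨a, b, ?_⟩
  filter_upwards [hae] with x hx
  have := hb (x - x₀)
  simp only [sub_add_cancel] at this
  rw [hx, ha, mul_assoc, ← Complex.exp_add, (div_eq_iff (hne x₀)).1 this, mul_comm]
  congr 2
  push_cast; ring

/-! ### A Steinhaus argument for almost translation invariant sets. -/

theorem quasi_sub_right (y : ℝ) :
    Measure.QuasiMeasurePreserving (fun ξ : ℝ => ξ - y) volume volume :=
  (measurePreserving_sub_right volume y).quasiMeasurePreserving

/-- A set of positive measure that contains almost all of its translates by the differences of
almost all pairs of points of another set of positive measure has full measure. -/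
theorem ae_mem_of_ae_translate {Ω H : Set ℝ} (hΩ : MeasurableSet Ω) (hH : MeasurableSet H)
    (hΩ0 : volume Ω ≠ 0) (hH0 : volume H ≠ 0)
    (h : ∀ᵐ τ, ∀ᵐ ζ, τ ∈ H → ζ ∈ H → ∀ᵐ ξ, ξ ∉ Ω → ξ - (τ - ζ) ∉ Ω) :
    ∀ᵐ ξ, ξ ∈ Ω := by
  -- `S` consists of the shifts under which the complement of `Ω` is stable up to null sets. It is
  -- closed under addition but not obviously under negation, so the group used below is its
  -- symmetric part.
  set S : Set ℝ := {y | ∀ᵐ ξ, ξ ∉ Ω → ξ - y ∉ Ω} with hSdef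
  have hpm : MeasurableSet {q : ℝ × ℝ | q.2 ∉ Ω → q.2 - q.1 ∉ Ω} := by
    have e : {q : ℝ × ℝ | q.2 ∉ Ω → q.2 - q.1 ∉ Ω} =
        Prod.snd ⁻¹' Ω ∪ ((fun q : ℝ × ℝ => q.2 - q.1) ⁻¹' Ω)ᶜ := by
      ext q; simp only [Set.mem_ofPred_eq, Set.mem_union, Set.mem_preimage, Set.mem_compl_iff]
      tauto
    rw [e]
    exact (measurable_snd hΩ).union ((by fun_prop : Measurable fun q : ℝ × ℝ => q.2 - q.1) hΩ).compl
  have hS : MeasurableSet S := by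
    have := measurable_measure_prodMk_left (ν := (volume : Measure ℝ)) hpm.compl
    exact this (measurableSet_singleton 0)
  have hSadd : ∀ y ∈ S, ∀ y' ∈ S, y + y' ∈ S := by
    intro y hy y' hy'
    have h2 := (quasi_sub_right y).ae hy'
    simp only [hSdef, Set.mem_ofPred_eq] at hy ⊢
    filter_upwards [hy, h2] with ξ a b c
    have := b (a c)
    rwa [sub_sub] at this
  have h0 : (0 : ℝ) ∈ S := by simp [hSdef]
  set G : AddSubgroup ℝ :=
    { carrier := {y | y ∈ S ∧ -y ∈ S}
      zero_mem' := ⟨h0, by simpa using h0⟩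
      add_mem' := fun {a b} ha hb => ⟨hSadd _ ha.1 _ hb.1, by
        rw [neg_add]; exact hSadd _ ha.2 _ hb.2⟩
      neg_mem' := fun {a} ha => ⟨ha.2, by simpa using ha.1⟩ } with hG
  have hGmem : ∀ y, y ∈ G ↔ y ∈ S ∧ -y ∈ S := fun y => Iff.rfl
  have h' : ∀ᵐ ζ, ∀ᵐ τ, τ ∈ H → ζ ∈ H → τ - ζ ∈ S := by
    refine (Measure.ae_ae_comm (μ := volume) (ν := volume)
      (p := fun τ ζ => τ ∈ H → ζ ∈ H → τ - ζ ∈ S) ?_).1 h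
    have e : {q : ℝ × ℝ | q.1 ∈ H → q.2 ∈ H → q.1 - q.2 ∈ S} =
        (Prod.fst ⁻¹' H)ᶜ ∪ (Prod.snd ⁻¹' H)ᶜ ∪ ((fun q : ℝ × ℝ => q.1 - q.2) ⁻¹' S) := by
      ext q; simp only [Set.mem_ofPred_eq, Set.mem_union, Set.mem_preimage, Set.mem_compl_iff]
      tauto
    rw [e]
    exact ((measurable_fst hH).compl.union (measurable_snd hH).compl).union
      ((by fun_prop : Measurable fun q : ℝ × ℝ => q.1 - q.2) hS)
  -- One `ζ₀` serves for both signs of the difference, so almost all of `H - ζ₀` lies in the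
  -- symmetric part `G`.
  obtain ⟨ζ₀, hζ₀, hA, hB⟩ : ∃ ζ₀ ∈ H, (∀ᵐ τ, τ ∈ H → ζ₀ - τ ∈ S) ∧ ∀ᵐ τ, τ ∈ H → τ - ζ₀ ∈ S := by
    by_contra hcon
    refine hH0 (measure_mono_null (t := {ζ | ¬ (ζ ∉ H)}) (fun x hx => not_not.2 hx) ?_)
    change ∀ᵐ ζ, ζ ∉ H
    filter_upwards [h, h'] with ζ h1 h2 hζ
    exact hcon ⟨ζ, hζ, h1.mono fun τ hτ hτH => hτ hζ hτH, h2.mono fun τ hτ hτH => hτ hτH hζ⟩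
  set T : Set ℝ := {τ | τ ∈ H ∧ ζ₀ - τ ∈ S ∧ τ - ζ₀ ∈ S} with hT
  have hTm : MeasurableSet T :=
    hH.inter (((by fun_prop : Measurable fun τ : ℝ => ζ₀ - τ) hS).inter
      ((by fun_prop : Measurable fun τ : ℝ => τ - ζ₀) hS))
  have hT0 : 0 < volume T := by
    have : volume T = volume H := by
      refine measure_congr ?_
      filter_upwards [hA, hB] with τ h1 h2
      refine propext ⟨fun hτ => hτ.1, fun hτ => ⟨hτ, h1 hτ, h2 hτ⟩⟩
    rw [this]; exact pos_iff_ne_zero.2 hH0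
  have hTG : T - T ⊆ (G : Set ℝ) := by
    rintro _ ⟨a, ha, b, hb, rfl⟩
    have ha' : a - ζ₀ ∈ G := (hGmem _).2 ⟨ha.2.2, by simpa using ha.2.1⟩
    have hb' : b - ζ₀ ∈ G := (hGmem _).2 ⟨hb.2.2, by simpa using hb.2.1⟩
    have := G.sub_mem ha' hb'
    simpa using this
  -- By Steinhaus `T - T` is a neighbourhood of zero. Hence `G` is open, therefore closed, and
  -- equals `ℝ` by connectedness.
  have hnhds : (G : Set ℝ) ∈ nhds (0 : ℝ) :=
    Filter.mem_of_superset (Measure.sub_mem_nhds_zero_of_addHaar_pos volume T hTm hT0) hTG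
  have hopen : IsOpen (G : Set ℝ) := G.isOpen_of_mem_nhds hnhds
  have hclosed : IsClosed (G : Set ℝ) := OpenAddSubgroup.isClosed ⟨G, hopen⟩
  have huniv : (G : Set ℝ) = Set.univ := IsClopen.eq_univ ⟨hclosed, hopen⟩ ⟨0, G.zero_mem⟩
  have hall : ∀ y, y ∈ S := fun y => ((hGmem y).1 (by
    have : y ∈ (G : Set ℝ) := huniv ▸ Set.mem_univ y
    exact this)).1
  -- With the quantifiers exchanged, a single typical point `ξ ∉ Ω` would put almost every `ξ - y`
  -- outside `Ω` and make `Ω` null.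
  have hsw : ∀ᵐ ξ, ∀ᵐ y : ℝ, ξ ∉ Ω → ξ - y ∉ Ω :=
    (Measure.ae_ae_comm (μ := volume) (ν := volume)
      (p := fun y ξ : ℝ => ξ ∉ Ω → ξ - y ∉ Ω) hpm).1 (Filter.Eventually.of_forall hall)
  filter_upwards [hsw] with ξ hξ
  by_contra hc
  have : ∀ᵐ y : ℝ, ξ - y ∉ Ω := hξ.mono fun y hy => hy hc
  have h3 := (quasi_sub ξ).ae this
  simp only [sub_sub_cancel] at h3
  exact hΩ0 (by simpa [ae_iff] using h3)

/-! ### The `L^(2n+2)` norm through convolution powers of the transform. -/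

/-- The modulus of the Fourier transform of `u`, with values in `ℝ≥0∞`. -/
noncomputable def specAbs (u : L2) : ℝ → ℝ≥0∞ := fun η => ‖(𝓕 u : L2) η‖ₑ

theorem measurable_L2 (u : L2) : Measurable (u : ℝ → ℂ) := (Lp.stronglyMeasurable u).measurable

@[fun_prop]
theorem measurable_specAbs (u : L2) : Measurable (specAbs u) :=
  (measurable_L2 _).enorm

theorem lintegral_enorm_sq_eq (u : L2) : ∫⁻ x, ‖u x‖ₑ ^ 2 = ‖u‖ₑ ^ 2 := by
  rw [Lp.enorm_def, eLpNorm_eq_lintegral_rpow_enorm_toReal (by norm_num) (by norm_num),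
    ← ENNReal.rpow_mul_natCast]
  simp

theorem lintegral_specAbs_sq (u : L2) : ∫⁻ η, specAbs u η ^ 2 = ∫⁻ x, ‖u x‖ₑ ^ 2 := by
  rw [lintegral_enorm_sq_eq]
  have := lintegral_enorm_sq_eq (𝓕 u)
  change ∫⁻ η, ‖(𝓕 u : L2) η‖ₑ ^ 2 = _
  rw [this, ← ofReal_norm, ← ofReal_norm, Lp.norm_fourier_eq]

theorem lconvolution_congr_ae {f f' g g' : ℝ → ℝ≥0∞} (hf : f =ᵐ[volume] f') (hg : g =ᵐ[volume] g') :
    f ⋆ₗ g = f' ⋆ₗ g' := by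
  funext ξ
  rw [lconvolution_def, lconvolution_def]
  refine lintegral_congr_ae ?_
  filter_upwards [hf, (quasi_sub ξ).ae_eq_comp hg] with η h1 h2
  simp only [Function.comp_apply] at h2
  rw [h1, neg_add_eq_sub, h2]

theorem convPow_congr_ae {f g : ℝ → ℝ≥0∞} (h : f =ᵐ[volume] g) (n : ℕ) :
    convPow f n =ᵐ[volume] convPow g n := by
  induction n with
  | zero => exact h
  | succ n ih => exact Filter.Eventually.of_forall fun x => congrFun (lconvolution_congr_ae h ih) x

theorem enorm_integral_mul_sub_le (u w : L2) (ξ : ℝ) :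
    ‖∫ η : ℝ, (𝓕 u : L2) η * (𝓕 w : L2) (ξ - η)‖ₑ ≤ (specAbs u ⋆ₗ specAbs w) ξ := by
  refine (enorm_integral_le_lintegral_enorm _).trans (le_of_eq ?_)
  rw [lconvolution_def]
  refine lintegral_congr fun η => ?_
  rw [enorm_mul, neg_add_eq_sub]; rfl

/-- The product of two `L²` functions is a priori only integrable. The hypothesis makes the
convolution of the transforms square integrable, and its inverse transform is the product. -/
theorem exists_mul_L2 {u w : L2} (h : ∫⁻ ξ, (specAbs u ⋆ₗ specAbs w) ξ ^ 2 < ∞) :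
    ∃ V : L2, (V =ᵐ[volume] fun x => u x * w x) ∧
      (𝓕 V : L2) =ᵐ[volume] fun ξ => ∫ η : ℝ, (𝓕 u : L2) η * (𝓕 w : L2) (ξ - η) := by
  set g : ℝ → ℂ := fun ξ => ∫ η : ℝ, (𝓕 u : L2) η * (𝓕 w : L2) (ξ - η) with hg
  have hgm : StronglyMeasurable g := by
    refine StronglyMeasurable.integral_prod_right
      (f := fun ξ η : ℝ => (𝓕 u : L2) η * (𝓕 w : L2) (ξ - η)) ?_
    have h1 := measurable_L2 (𝓕 u)
    have h2 := measurable_L2 (𝓕 w)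
    refine Measurable.stronglyMeasurable ?_
    simp only [Function.uncurry_def]
    exact (h1.comp measurable_snd).mul (h2.comp (by fun_prop))
  have hgL : MemLp g 2 volume := by
    refine ⟨hgm.aestronglyMeasurable, ?_⟩
    rw [eLpNorm_lt_top_iff_lintegral_rpow_enorm_lt_top (by norm_num) (by norm_num)]
    refine lt_of_le_of_lt (lintegral_mono fun ξ => ?_) h
    simp only [ENNReal.toReal_ofNat, ENNReal.rpow_ofNat]
    gcongr
    exact enorm_integral_mul_sub_le u w ξ
  refine ⟨𝓕⁻ (hgL.toLp g), (mul_ae_eq_fourierInv u w _ hgL.coeFn_toLp).symm, ?_⟩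
  rw [fourier_fourierInv_eq]
  exact hgL.coeFn_toLp

/-- The transform of `u ^ (n + 2)` is the convolution of those of `u` and `u ^ (n + 1)`. -/
theorem fourier_pow_succ {u V V' : L2} {n : ℕ} (hV : V =ᵐ[volume] fun x => u x ^ (n + 1))
    (hV' : V' =ᵐ[volume] fun x => u x ^ (n + 2))
    (h : ∫⁻ ξ, (specAbs u ⋆ₗ specAbs V) ξ ^ 2 < ∞) :
    (𝓕 V' : L2) =ᵐ[volume] fun ξ => ∫ η : ℝ, (𝓕 u : L2) η * (𝓕 V : L2) (ξ - η) := by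
  obtain ⟨W, h1, h2⟩ := exists_mul_L2 h
  have : V' = W := by
    refine Lp.ext ?_
    filter_upwards [hV, hV', h1] with x a b c
    rw [b, c, a]; ring
  rw [this]; exact h2

theorem lintegral_lconvolution_sq_lt_top {u V : L2} {n : ℕ}
    (hu : ∫⁻ x, weight 1 x * specAbs u x ^ 2 < ∞)
    (hle : specAbs V ≤ᵐ[volume] convPow (specAbs u) n) :
    ∫⁻ ξ, (specAbs u ⋆ₗ specAbs V) ξ ^ 2 < ∞ := by
  refine lt_of_le_of_lt (lintegral_mono fun ξ => ?_)
    (lintegral_convPow_sq_lt_top (measurable_specAbs u) hu (n + 1))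
  gcongr
  refine lintegral_mono_ae ?_
  filter_upwards [(quasi_sub ξ).ae hle] with η hη
  rw [neg_add_eq_sub]
  gcongr

theorem exists_pow_L2 {u : L2} (hu : ∫⁻ x, weight 1 x * specAbs u x ^ 2 < ∞) (n : ℕ) :
    ∃ V : L2, (V =ᵐ[volume] fun x => u x ^ (n + 1)) ∧
      specAbs V ≤ᵐ[volume] convPow (specAbs u) n := by
  induction n with
  | zero => exact ⟨u, by simp, Filter.Eventually.of_forall fun x => le_rfl⟩
  | succ n ih =>
    obtain ⟨V, hV, hle⟩ := ih
    have hfin := lintegral_lconvolution_sq_lt_top hu hle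
    obtain ⟨W, h1, h2⟩ := exists_mul_L2 hfin
    refine ⟨W, ?_, ?_⟩
    · filter_upwards [hV, h1] with x a b
      rw [b, a]; ring
    · filter_upwards [h2] with ξ hξ
      rw [specAbs, hξ]
      refine (enorm_integral_mul_sub_le u V ξ).trans ?_
      refine lintegral_mono_ae ?_
      filter_upwards [(quasi_sub ξ).ae hle] with η hη
      rw [neg_add_eq_sub]
      gcongr

/-- For a nonnegative transform no cancellation occurs, so the bound of `exists_pow_L2` becomes an
equality. The convolution powers are finite almost everywhere, so `toReal` loses nothing. -/
theorem exists_pow_L2_of_nonneg {u : L2} (hu : ∫⁻ x, weight 1 x * specAbs u x ^ 2 < ∞)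
    (h0 : (𝓕 u : L2) =ᵐ[volume] fun η => ((specAbs u η).toReal : ℂ)) (n : ℕ) :
    ∃ V : L2, (V =ᵐ[volume] fun x => u x ^ (n + 1)) ∧
      (𝓕 V : L2) =ᵐ[volume] fun η => ((convPow (specAbs u) n η).toReal : ℂ) := by
  have hfin : ∀ n, ∀ᵐ ξ, convPow (specAbs u) n ξ < ∞ := by
    intro n
    have := ae_lt_top ((measurable_convPow (measurable_specAbs u) n).pow_const 2)
      (lintegral_convPow_sq_lt_top (measurable_specAbs u) hu n).ne
    filter_upwards [this] with ξ hξ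
    by_contra hc
    rw [not_lt, top_le_iff] at hc
    simp [hc] at hξ
  induction n with
  | zero => exact ⟨u, by simp, h0⟩
  | succ n ih =>
    obtain ⟨V, hV, hF⟩ := ih
    have hle : specAbs V ≤ᵐ[volume] convPow (specAbs u) n := by
      filter_upwards [hF] with ξ h1
      rw [specAbs, h1, ← ofReal_norm, Complex.norm_real, Real.norm_of_nonneg ENNReal.toReal_nonneg]
      exact ENNReal.ofReal_toReal_le
    obtain ⟨W, h1, h2⟩ := exists_mul_L2 (lintegral_lconvolution_sq_lt_top hu hle)
    refine ⟨W, ?_, ?_⟩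
    · filter_upwards [hV, h1] with x a b
      rw [b, a]; ring
    · filter_upwards [h2, hfin (n + 1)] with ξ hξ hξf
      rw [hξ]
      have hm := (measurable_convPow (measurable_specAbs u) n)
      have hm' : Measurable fun η => specAbs u η * convPow (specAbs u) n (-η + ξ) := by fun_prop
      have e : (convPow (specAbs u) (n + 1) ξ).toReal =
          ∫ η, (specAbs u η * convPow (specAbs u) n (-η + ξ)).toReal := by
        rw [integral_toReal hm'.aemeasurable (ae_lt_top hm' hξf.ne)]
        rfl
      rw [e, ← integral_complex_ofReal]
      refine integral_congr_ae ?_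
      filter_upwards [h0, (quasi_sub ξ).ae hF] with η a b
      rw [a, b, ENNReal.toReal_mul, neg_add_eq_sub]
      push_cast; rfl

theorem integral_norm_pow_eq {u V : L2} {n : ℕ} (hV : V =ᵐ[volume] fun x => u x ^ (n + 1)) :
    ∫ x, ‖u x‖ ^ (2 * n + 2) = (∫⁻ ξ, specAbs V ξ ^ 2).toReal := by
  rw [lintegral_specAbs_sq, ← integral_toReal]
  · refine integral_congr_ae ?_
    filter_upwards [hV] with x hx
    rw [ENNReal.toReal_pow, toReal_enorm, hx, norm_pow, ← pow_mul]
    congr 1; ring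
  · exact ((measurable_L2 V).enorm.pow_const 2).aemeasurable
  · exact Filter.Eventually.of_forall fun x => by finiteness

theorem integral_norm_pow_le {u : L2} (hu : ∫⁻ x, weight 1 x * specAbs u x ^ 2 < ∞) (n : ℕ) :
    ∫ x, ‖u x‖ ^ (2 * n + 2) ≤ (∫⁻ ξ, convPow (specAbs u) n ξ ^ 2).toReal := by
  obtain ⟨V, hV, hle⟩ := exists_pow_L2 hu n
  rw [integral_norm_pow_eq hV]
  refine ENNReal.toReal_mono (lintegral_convPow_sq_lt_top (measurable_specAbs u) hu n).ne
    (lintegral_mono_ae ?_)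
  filter_upwards [hle] with x hx
  gcongr

theorem integral_norm_pow_of_nonneg {u : L2} (hu : ∫⁻ x, weight 1 x * specAbs u x ^ 2 < ∞)
    (h0 : (𝓕 u : L2) =ᵐ[volume] fun η => ((specAbs u η).toReal : ℂ)) (n : ℕ) :
    ∫ x, ‖u x‖ ^ (2 * n + 2) = (∫⁻ ξ, convPow (specAbs u) n ξ ^ 2).toReal := by
  obtain ⟨V, hV, hF⟩ := exists_pow_L2_of_nonneg hu h0 n
  rw [integral_norm_pow_eq hV]
  congr 1
  have hfin := ae_lt_top ((measurable_convPow (measurable_specAbs u) n).pow_const 2)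
      (lintegral_convPow_sq_lt_top (measurable_specAbs u) hu n).ne
  refine lintegral_congr_ae ?_
  filter_upwards [hF, hfin] with x hx hx2
  have : convPow (specAbs u) n x ≠ ∞ := fun hc => by simp [hc] at hx2
  rw [specAbs, hx, ← ofReal_norm, Complex.norm_real, Real.norm_of_nonneg ENNReal.toReal_nonneg,
    ENNReal.ofReal_toReal this]

theorem integral_norm_pow_pos {u : L2} (hu : ∫⁻ x, weight 1 x * specAbs u x ^ 2 < ∞) (n : ℕ)
    (hne : u ≠ 0) : 0 < ∫ x, ‖u x‖ ^ (2 * n + 2) := by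
  obtain ⟨V, hV, -⟩ := exists_pow_L2 hu n
  rw [integral_norm_pow_eq hV, lintegral_specAbs_sq, lintegral_enorm_sq_eq]
  have : V ≠ 0 := by
    rintro rfl
    refine hne (Lp.ext ?_)
    filter_upwards [hV, Lp.coeFn_zero ℂ 2 (volume : Measure ℝ)] with x h1 h2
    rw [h2] at h1 ⊢
    exact eq_zero_of_pow_eq_zero h1.symm
  rw [ENNReal.toReal_pow, toReal_enorm]
  have := norm_pos_iff.2 this
  positivity

theorem lintegral_convPow_ne_zero {f : ℝ → ℝ≥0∞} (hf : Measurable f) (h : ∫⁻ x, f x ≠ 0) (n : ℕ) :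
    ∫⁻ x, convPow f n x ≠ 0 := by
  induction n with
  | zero => exact h
  | succ n ih =>
    rw [convPow, lintegral_lconvolution hf (measurable_convPow hf n)]
    exact mul_ne_zero h ih

theorem fourier_ne_zero {u : L2} (hu : u ≠ 0) : (𝓕 u : L2) ≠ 0 := by
  intro h
  apply hu
  rw [← norm_eq_zero, ← Lp.norm_fourier_eq, h, norm_zero]

theorem volume_specAbs_ne_zero {u : L2} (hu : u ≠ 0) : volume {ξ | specAbs u ξ ≠ 0} ≠ 0 := by
  intro h
  refine fourier_ne_zero hu (Lp.ext ?_)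
  have h' : ∀ᵐ ξ, specAbs u ξ = 0 := by rw [ae_iff]; exact h
  filter_upwards [h', Lp.coeFn_zero ℂ 2 (volume : Measure ℝ)] with x h1 h2
  rw [h2]
  simpa [specAbs] using h1

/-! ### Bounds on the symbol and positivity of the energy. -/

theorem lintegral_weight_specAbs_sq_lt_top {s : ℝ} (hs : 1 / 2 ≤ s) {u : L2} (hu : MemHs s u) :
    ∫⁻ x, weight 1 x * specAbs u x ^ 2 < ∞ := by
  rw [memHs_iff] at hu
  have h2 := (hu.const_mul 2).lintegral_lt_top
  refine lt_of_le_of_lt (lintegral_mono fun x => ?_) h2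
  simp only [weight, specAbs, Real.rpow_one, ← ofReal_norm]
  rw [← ENNReal.ofReal_pow (norm_nonneg _), ← ENNReal.ofReal_mul (by positivity), ← mul_assoc]
  refine ENNReal.ofReal_le_ofReal ?_
  gcongr
  have h1 : (1 + x ^ 2) ^ (1 / 2 : ℝ) ≤ (1 + x ^ 2) ^ s :=
    Real.rpow_le_rpow_of_exponent_le (by nlinarith [sq_nonneg x]) hs
  have h3 : 1 ≤ (1 + x ^ 2) ^ (1 / 2 : ℝ) :=
    Real.one_le_rpow (by nlinarith [sq_nonneg x]) (by norm_num)
  have h4 : |x| ≤ (1 + x ^ 2) ^ (1 / 2 : ℝ) := by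
    rw [← Real.sqrt_eq_rpow]
    exact Real.abs_le_sqrt (by linarith)
  linarith

theorem SymbolAssumption.bddBelow {p : ℝ → ℝ} {s A v : ℝ} (hp : SymbolAssumption p s A)
    (hv : s = 1 / 2 → |v| < A) : BddBelow (Set.range fun ξ : ℝ => p ξ - v * ξ) := by
  obtain ⟨-, hs, hA, B, c, hB, h⟩ := hp
  have key : ∃ M : ℝ, ∀ t : ℝ, 0 ≤ t → |v| * t ≤ A * t ^ (2 * s) + M := by
    rcases hs.eq_or_lt with h2 | h2
    · refine ⟨0, fun t ht => ?_⟩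
      rw [← h2]
      have := hv h2.symm
      norm_num
      gcongr
    -- `R` is the threshold beyond which `A * t ^ (2 * s - 1)` dominates `|v|`.
    · set R := (|v| / A) ^ (1 / (2 * s - 1)) with hR
      have hs1 : 0 < 2 * s - 1 := by linarith
      have hR0 : 0 ≤ R := by positivity
      refine ⟨|v| * R, fun t ht => ?_⟩
      rcases le_total t R with h3 | h3
      · have : 0 ≤ A * t ^ (2 * s) := by positivity
        have : |v| * t ≤ |v| * R := by gcongr
        linarith
      · have h4 : |v| / A ≤ t ^ (2 * s - 1) := by
          calc |v| / A = R ^ (2 * s - 1) := by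
                rw [hR, ← Real.rpow_mul (by positivity), one_div_mul_cancel hs1.ne', Real.rpow_one]
            _ ≤ _ := by gcongr
        have h5 : t ^ (2 * s) = t ^ (2 * s - 1) * t := by
          rcases ht.eq_or_lt with h0 | h0
          · rw [← h0, Real.zero_rpow (by linarith)]; simp
          · rw [← Real.rpow_add_one h0.ne']; ring_nf
        have h6 : |v| ≤ A * t ^ (2 * s - 1) := by
          rw [div_le_iff₀ hA] at h4; linarith
        have h7 : |v| * t ≤ A * t ^ (2 * s - 1) * t := by gcongr
        have : 0 ≤ |v| * R := by positivity
        rw [h5]; linarith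
  obtain ⟨M, hM⟩ := key
  refine ⟨c - M, ?_⟩
  rintro _ ⟨ξ, rfl⟩
  have h1 := (h ξ).1
  have h2 := hM |ξ| (abs_nonneg _)
  have h3 : v * ξ ≤ |v| * |ξ| := by rw [← abs_mul]; exact le_abs_self _
  simp only
  linarith

theorem SymbolAssumption.exists_pos_le {p : ℝ → ℝ} {s A v ω : ℝ} (hp : SymbolAssumption p s A)
    (hv : s = 1 / 2 → |v| < A) (hω : -symbolInf p v < ω) (ξ : ℝ) : 0 < p ξ - v * ξ + ω := by
  have := ciInf_le (hp.bddBelow hv) ξ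
  unfold symbolInf at hω
  linarith

/-- The symbol of the energy in the frequency variable of Mathlib's Fourier transform. -/
noncomputable def energySymbol (p : ℝ → ℝ) (v ω η : ℝ) : ℝ :=
  p (2 * Real.pi * η) - v * (2 * Real.pi * η) + ω

theorem SymbolAssumption.continuous_energySymbol {p : ℝ → ℝ} {s A : ℝ}
    (hp : SymbolAssumption p s A) (v ω : ℝ) : Continuous (energySymbol p v ω) := by
  have := hp.1
  unfold energySymbol
  fun_prop

/-- The substitution `ξ = 2πη`; its Jacobian cancels the factor `(2π)⁻¹` of the unitary
normalization. -/
theorem energyForm_eq (p : ℝ → ℝ) (v ω : ℝ) (u : L2) :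
    energyForm p v ω u = ∫ η, energySymbol p v ω η * ‖(𝓕 u : L2) η‖ ^ 2 := by
  have hpi : (0 : ℝ) < 2 * Real.pi := by positivity
  have h := Measure.integral_comp_div
    (fun η => energySymbol p v ω η * ‖(𝓕 u : L2) η‖ ^ 2) (2 * Real.pi)
  have h2 : energyForm p v ω u = ∫ ξ, (2 * Real.pi)⁻¹ *
      (energySymbol p v ω (ξ / (2 * Real.pi)) * ‖(𝓕 u : L2) (ξ / (2 * Real.pi))‖ ^ 2) := by
    refine integral_congr_ae (Filter.Eventually.of_forall fun ξ => ?_)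
    simp only [fourierHat, energySymbol]
    rw [norm_mul, Complex.norm_real, Real.norm_of_nonneg (by positivity), mul_pow, inv_pow,
      Real.sq_sqrt hpi.le, mul_div_cancel₀ _ hpi.ne']
    ring
  rw [h2, integral_const_mul, h, abs_of_pos hpi, smul_eq_mul, inv_mul_cancel_left₀ hpi.ne']

theorem SymbolAssumption.energySymbol_le {p : ℝ → ℝ} {s A : ℝ} (hp : SymbolAssumption p s A)
    (v ω : ℝ) : ∃ C : ℝ, ∀ η, energySymbol p v ω η ≤ C * (1 + η ^ 2) ^ s := by
  obtain ⟨-, hs, hA, B, c, hB, h⟩ := hp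
  refine ⟨B * (2 * Real.pi) ^ (2 * s) + |v| * (2 * Real.pi) + |ω|, fun η => ?_⟩
  have hpi : (0 : ℝ) < 2 * Real.pi := by positivity
  have h1 := (h (2 * Real.pi * η)).2
  have hb : (1 : ℝ) ≤ 1 + η ^ 2 := by nlinarith [sq_nonneg η]
  have e1 : |2 * Real.pi * η| ^ (2 * s) ≤ (2 * Real.pi) ^ (2 * s) * (1 + η ^ 2) ^ s := by
    rw [abs_mul, abs_of_pos hpi, Real.mul_rpow hpi.le (abs_nonneg _)]
    gcongr
    rw [Real.rpow_mul (abs_nonneg _), Real.rpow_two, sq_abs]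
    gcongr
    linarith
  have e2 : |η| ≤ (1 + η ^ 2) ^ s := by
    calc |η| ≤ (1 + η ^ 2) ^ (1 / 2 : ℝ) := by
          rw [← Real.sqrt_eq_rpow]; exact Real.abs_le_sqrt (by linarith)
      _ ≤ _ := Real.rpow_le_rpow_of_exponent_le hb hs
  have e3 : 1 ≤ (1 + η ^ 2) ^ s := Real.one_le_rpow hb (by linarith)
  have e4 : -(v * (2 * Real.pi * η)) ≤ |v| * (2 * Real.pi) * (1 + η ^ 2) ^ s := by
    calc -(v * (2 * Real.pi * η)) ≤ |v * (2 * Real.pi * η)| := neg_le_abs _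
      _ = |v| * (2 * Real.pi) * |η| := by rw [abs_mul, abs_mul, abs_of_pos hpi]; ring
      _ ≤ _ := by gcongr
  have e5 : ω ≤ |ω| * (1 + η ^ 2) ^ s :=
    (le_abs_self ω).trans (le_mul_of_one_le_right (abs_nonneg _) e3)
  have e6 : B * |2 * Real.pi * η| ^ (2 * s) ≤ B * ((2 * Real.pi) ^ (2 * s) * (1 + η ^ 2) ^ s) := by
    gcongr
  unfold energySymbol
  linarith

theorem SymbolAssumption.integrable_energy {p : ℝ → ℝ} {s A v ω : ℝ} (hp : SymbolAssumption p s A)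
    (hv : s = 1 / 2 → |v| < A) (hω : -symbolInf p v < ω) {u : L2} (hu : MemHs s u) :
    Integrable fun η => energySymbol p v ω η * ‖(𝓕 u : L2) η‖ ^ 2 := by
  obtain ⟨C, hC⟩ := hp.energySymbol_le v ω
  refine ((memHs_iff.1 hu).const_mul C).mono' ?_ (Filter.Eventually.of_forall fun η => ?_)
  · exact (hp.continuous_energySymbol v ω).aestronglyMeasurable.mul
      ((Lp.aestronglyMeasurable _).norm.pow 2)
  · have h0 : 0 < energySymbol p v ω η := hp.exists_pos_le hv hω _
    rw [Real.norm_of_nonneg (by positivity), ← mul_assoc]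
    gcongr
    exact hC η

theorem SymbolAssumption.energyForm_pos {p : ℝ → ℝ} {s A v ω : ℝ} (hp : SymbolAssumption p s A)
    (hv : s = 1 / 2 → |v| < A) (hω : -symbolInf p v < ω) {u : L2} (hu : MemHs s u) (h0 : u ≠ 0) :
    0 < energyForm p v ω u := by
  rw [energyForm_eq]
  have hpos : ∀ η, 0 < energySymbol p v ω η := fun η => hp.exists_pos_le hv hω _
  have hnn : ∀ η, 0 ≤ energySymbol p v ω η * ‖(𝓕 u : L2) η‖ ^ 2 := fun η => by
    have := hpos η; positivity
  rw [integral_pos_iff_support_of_nonneg hnn (hp.integrable_energy hv hω hu), pos_iff_ne_zero]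
  convert volume_specAbs_ne_zero h0 using 2
  ext η
  simp [specAbs, (hpos η).ne']

/-! ### One-sided first variation. -/

/-- First order comparison of powers along a quadratic perturbation. -/
theorem nonpos_of_forall_pow_mul_le {E e N T : ℝ} {k : ℕ}
    (hE : 0 < E) (h : ∀ ε : ℝ, 0 < ε → E ^ k * (N + ε * T) ≤ N * (E + ε ^ 2 * e) ^ k) : T ≤ 0 := by
  -- The perturbation of `E` is quadratic, so only the linear term in `T` survives in the derivative
  -- at zero.
  have hd : HasDerivAt (fun ε : ℝ => N * (E + ε ^ 2 * e) ^ k - E ^ k * (N + ε * T))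
      (-(E ^ k * T)) 0 := by
    have h1 : HasDerivAt (fun ε : ℝ => E + ε ^ 2 * e) 0 0 := by
      simpa using (((hasDerivAt_id (0 : ℝ)).pow 2).mul_const e).const_add E
    have h2 := (h1.pow k).const_mul N
    have h3 : HasDerivAt (fun ε : ℝ => E ^ k * (N + ε * T)) (E ^ k * T) 0 := by
      simpa using (((hasDerivAt_id (0 : ℝ)).mul_const T).const_add N).const_mul (E ^ k)
    exact (h2.sub h3).congr_deriv (by simp)
  have ht := hd.tendsto_slope_zero_right
  have : 0 ≤ -(E ^ k * T) := by
    refine ge_of_tendsto ht ?_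
    filter_upwards [self_mem_nhdsWithin] with ε hε
    have hε : 0 < ε := hε
    have := h ε hε
    simp only [zero_add, smul_eq_mul]
    refine mul_nonneg (by positivity) ?_
    norm_num
    linarith
  have hk : 0 < E ^ k := by positivity
  nlinarith

/-! ### Invariance of the Sobolev condition and the energy under `u ↦ u^•`. -/

theorem fourier_bullet_ae (u : L2) :
    (𝓕 (bullet u) : L2) =ᵐ[volume] fun η => ((‖(𝓕 u : L2) η‖ : ℝ) : ℂ) := by
  have h : (𝓕 (bullet u) : L2) = absL2 (𝓕 u) := fourier_fourierInv_eq _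
  rw [h]
  exact MemLp.coeFn_toLp (Lp.memLp (𝓕 u : L2)).norm.ofReal

theorem specAbs_bullet (u : L2) : specAbs (bullet u) =ᵐ[volume] specAbs u := by
  filter_upwards [fourier_bullet_ae u] with η h
  rw [specAbs, specAbs, h, ← ofReal_norm, Complex.norm_real, norm_norm, ofReal_norm]

theorem fourier_bullet_nonneg (u : L2) :
    (𝓕 (bullet u) : L2) =ᵐ[volume] fun η => ((specAbs (bullet u) η).toReal : ℂ) := by
  filter_upwards [fourier_bullet_ae u, specAbs_bullet u] with η h1 h2
  rw [h1, h2, specAbs, toReal_enorm]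

theorem norm_fourier_bullet (u : L2) :
    ∀ᵐ η, ‖(𝓕 (bullet u) : L2) η‖ = ‖(𝓕 u : L2) η‖ := by
  filter_upwards [fourier_bullet_ae u] with η h1
  rw [h1, Complex.norm_real, norm_norm]

theorem memHs_bullet {s : ℝ} {u : L2} (hu : MemHs s u) : MemHs s (bullet u) := by
  rw [memHs_iff] at hu ⊢
  refine hu.congr ?_
  filter_upwards [norm_fourier_bullet u] with η h
  rw [h]

theorem bullet_ne_zero {u : L2} (hu : u ≠ 0) : bullet u ≠ 0 := by
  intro h
  have h1 := specAbs_bullet u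
  refine volume_specAbs_ne_zero hu ?_
  rw [h] at h1
  suffices h0 : ∀ᵐ ξ, specAbs u ξ = 0 by rwa [ae_iff] at h0
  have h2 : (𝓕 (0 : L2) : L2) = 0 := (Lp.fourierTransformₗᵢ ℝ ℂ).map_zero
  filter_upwards [h1, Lp.coeFn_zero ℂ 2 (volume : Measure ℝ)] with ξ a b
  rw [← a, specAbs, h2, b]
  simp

theorem energyForm_bullet (p : ℝ → ℝ) (v ω : ℝ) (u : L2) :
    energyForm p v ω (bullet u) = energyForm p v ω u := by
  rw [energyForm_eq, energyForm_eq]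
  refine integral_congr_ae ?_
  filter_upwards [norm_fourier_bullet u] with η h
  rw [h]

/-! ### Ground states: equality of norms and almost nowhere vanishing transform. -/

/-- By Tonelli the integral is a triple integral of `h τ * F (ξ - τ) * (h ζ * φ (ξ - ζ))`, so this
nonnegative integrand vanishes almost everywhere; then shift `ξ = η + ζ`. -/
theorem ae_of_lintegral_lconvolution_mul_eq_zero {F φ h : ℝ → ℝ≥0∞} (hF : Measurable F)
    (hφ : Measurable φ) (hh : Measurable h)
    (hT : ∫⁻ ξ, (F ⋆ₗ h) ξ * (φ ⋆ₗ h) ξ = 0) :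
    ∀ᵐ τ, ∀ᵐ ζ, h τ ≠ 0 → h ζ ≠ 0 → ∀ᵐ η, φ η ≠ 0 → F (η - (τ - ζ)) = 0 := by
  have e : ∫⁻ ξ, (F ⋆ₗ h) ξ * (φ ⋆ₗ h) ξ =
      ∫⁻ τ, ∫⁻ ζ, ∫⁻ ξ, h τ * F (ξ - τ) * (h ζ * φ (ξ - ζ)) := by
    rw [lconvolution_comm (f := F), lconvolution_comm (f := φ)]
    simp only [lconvolution_def, neg_add_eq_sub]
    calc ∫⁻ ξ, (∫⁻ τ, h τ * F (ξ - τ)) * ∫⁻ ζ, h ζ * φ (ξ - ζ)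
        = ∫⁻ ξ, ∫⁻ τ, ∫⁻ ζ, h τ * F (ξ - τ) * (h ζ * φ (ξ - ζ)) := by
          refine lintegral_congr fun ξ => ?_
          rw [← lintegral_mul_const _ (by fun_prop)]
          refine lintegral_congr fun τ => ?_
          rw [lintegral_const_mul _ (by fun_prop)]
      _ = ∫⁻ τ, ∫⁻ ξ, ∫⁻ ζ, h τ * F (ξ - τ) * (h ζ * φ (ξ - ζ)) := by
          refine lintegral_lintegral_swap (Measurable.aemeasurable ?_)
          unfold Function.uncurry
          exact Measurable.lintegral_prod_right' (f := fun q : (ℝ × ℝ) × ℝ =>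
            h q.1.2 * F (q.1.1 - q.1.2) * (h q.2 * φ (q.1.1 - q.2))) (by fun_prop)
      _ = _ := by
          refine lintegral_congr fun τ => ?_
          exact lintegral_lintegral_swap (by fun_prop)
  rw [e, lintegral_eq_zero_iff] at hT
  swap
  · refine Measurable.lintegral_prod_right
      (f := fun τ ζ => ∫⁻ ξ, h τ * F (ξ - τ) * (h ζ * φ (ξ - ζ))) ?_
    unfold Function.uncurry
    exact Measurable.lintegral_prod_right' (f := fun q : (ℝ × ℝ) × ℝ =>
      h q.1.1 * F (q.2 - q.1.1) * (h q.1.2 * φ (q.2 - q.1.2))) (by fun_prop)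
  filter_upwards [hT] with τ hτ
  simp only [Pi.zero_apply] at hτ
  rw [lintegral_eq_zero_iff] at hτ
  swap
  · exact Measurable.lintegral_prod_right (f := fun ζ ξ => h τ * F (ξ - τ) * (h ζ * φ (ξ - ζ)))
      (by unfold Function.uncurry; fun_prop)
  filter_upwards [hτ] with ζ hζ h1 h2
  simp only [Pi.zero_apply] at hζ
  rw [lintegral_eq_zero_iff (by fun_prop)] at hζ
  have q : Measure.QuasiMeasurePreserving (fun η : ℝ => η + ζ) volume volume :=
    (measurePreserving_add_right volume ζ).quasiMeasurePreserving
  filter_upwards [q.ae hζ] with η hη h3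
  simp only [Pi.zero_apply, add_sub_cancel_right, mul_eq_zero, h1, h2, h3, or_false, false_or] at hη
  rw [show η - (τ - ζ) = η + ζ - τ by ring]
  exact hη

/-- Lower bound for the convolution powers of a nonnegative perturbation. -/
theorem sq_convPow_add_le (F φ : ℝ → ℝ≥0∞) (hF : Measurable F) (ε : ℝ≥0∞) (m : ℕ) (ξ : ℝ) :
    convPow F (m + 1) ξ ^ 2 + ε * (2 * (convPow F (m + 1) ξ * (φ ⋆ₗ convPow F m) ξ)) ≤
      convPow (fun x => F x + ε * φ x) (m + 1) ξ ^ 2 := by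
  have h1 : convPow F (m + 1) ξ + ε * (φ ⋆ₗ convPow F m) ξ ≤
      convPow (fun x => F x + ε * φ x) (m + 1) ξ := by
    calc convPow F (m + 1) ξ + ε * (φ ⋆ₗ convPow F m) ξ
        ≤ ((fun x => F x + ε * φ x) ⋆ₗ convPow F m) ξ := by
          have hm := measurable_convPow hF m
          rw [convPow, lconvolution_def, lconvolution_def, lconvolution_def]
          calc (∫⁻ y, F y * convPow F m (-y + ξ)) + ε * ∫⁻ y, φ y * convPow F m (-y + ξ)
              ≤ (∫⁻ y, F y * convPow F m (-y + ξ)) + ∫⁻ y, ε * (φ y * convPow F m (-y + ξ)) := by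
                gcongr; exact lintegral_const_mul_le _ _
            _ = ∫⁻ y, (F y + ε * φ y) * convPow F m (-y + ξ) := by
                rw [← lintegral_add_left (by fun_prop)]
                refine lintegral_congr fun y => ?_
                ring
      -- The perturbation is kept in one convolution factor only; a positive multiple of the full
      -- first variation is all that is needed.
      _ ≤ _ := lconvolution_mono le_rfl (convPow_mono (fun x => le_self_add) m) ξ
  calc _ ≤ (convPow F (m + 1) ξ + ε * (φ ⋆ₗ convPow F m) ξ) ^ 2 := by
        rw [add_sq]
        refine le_trans (le_of_eq ?_) le_self_add
        ring
    _ ≤ _ := by gcongr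

/-- `Q^•` has the same energy as `Q`, so minimality says that its `L^(2σ+2)` norm is not larger,
while the convolution bound says that it is not smaller. -/
theorem IsBoostedGroundState.integral_norm_pow_eq {p : ℝ → ℝ} {s A v ω : ℝ} {σ : ℕ}
    (hp : SymbolAssumption p s A) (hv : s = 1 / 2 → |v| < A) (hω : -symbolInf p v < ω) {Q : L2}
    (hQ : IsBoostedGroundState p s v ω σ Q) :
    ∫ x, ‖Q x‖ ^ (2 * σ + 2) = (∫⁻ ξ, convPow (specAbs Q) σ ξ ^ 2).toReal := by
  obtain ⟨hH, h0, hmin⟩ := hQ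
  have hs : 1 / 2 ≤ s := hp.2.1
  have hX := lintegral_weight_specAbs_sq_lt_top hs hH
  have hP := memHs_bullet hH
  have hXP := lintegral_weight_specAbs_sq_lt_top hs hP
  refine le_antisymm (integral_norm_pow_le hX σ) ?_
  have hE := hp.energyForm_pos hv hω hH h0
  have hN := integral_norm_pow_pos hX σ h0
  have hNP := integral_norm_pow_pos hXP σ (bullet_ne_zero h0)
  have hle : weinstein p v ω σ Q ≤ weinstein p v ω σ (bullet Q) := hmin ⟨hP, bullet_ne_zero h0⟩
  unfold weinstein at hle
  rw [energyForm_bullet, div_le_div_iff_of_pos_left (by positivity) hN hNP] at hle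
  refine le_trans (le_of_eq ?_) hle
  rw [integral_norm_pow_of_nonneg hXP (fourier_bullet_nonneg Q)]
  congr 1
  refine lintegral_congr_ae ?_
  filter_upwards [convPow_congr_ae (specAbs_bullet Q) σ] with x hx
  rw [hx]

/-- The `L²` function whose Fourier transform is the indicator function of `B`. -/
noncomputable def bandL2 (B : Set ℝ) (hB : MeasurableSet B) (hfin : volume B ≠ ∞) : L2 :=
  𝓕⁻ (indicatorConstLp 2 hB hfin (1 : ℂ))

theorem fourier_bandL2 {B : Set ℝ} (hB : MeasurableSet B) (hfin : volume B ≠ ∞) :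
    (𝓕 (bandL2 B hB hfin) : L2) =ᵐ[volume] B.indicator fun _ => (1 : ℂ) := by
  rw [bandL2, fourier_fourierInv_eq]
  exact indicatorConstLp_coeFn

theorem memHs_bandL2 (s : ℝ) {B : Set ℝ} (hB : MeasurableSet B) (hfin : volume B ≠ ∞) {R : ℝ}
    (hR : B ⊆ Set.Icc (-R) R) : MemHs s (bandL2 B hB hfin) := by
  rw [memHs_iff]
  have hc : Continuous fun η : ℝ => (1 + η ^ 2) ^ s :=
    Continuous.rpow_const (by fun_prop) fun x => Or.inl (by positivity)
  have h : Integrable (B.indicator fun η : ℝ => (1 + η ^ 2) ^ s) :=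
    (hc.integrableOn_Icc.mono_set hR).integrable_indicator hB
  refine h.congr ?_
  filter_upwards [fourier_bandL2 hB hfin] with η hη
  rw [hη]
  by_cases hm : η ∈ B <;> simp [hm]

theorem fourier_add_smul_ae (u w : L2) (c : ℂ) :
    (𝓕 (u + c • w) : L2) =ᵐ[volume] fun η => (𝓕 u : L2) η + c * (𝓕 w : L2) η := by
  have : (𝓕 (u + c • w) : L2) = 𝓕 u + c • 𝓕 w := by
    rw [FourierTransform.fourier_add, FourierTransform.fourier_smul]
  rw [this]
  filter_upwards [Lp.coeFn_add (𝓕 u : L2) (c • 𝓕 w : L2), Lp.coeFn_smul c (𝓕 w : L2)] with x h1 h2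
  rw [h1, Pi.add_apply, h2, Pi.smul_apply, smul_eq_mul]

theorem memHs_add_smul {s : ℝ} {u w : L2} (hu : MemHs s u) (hw : MemHs s w) (c : ℂ) :
    MemHs s (u + c • w) := by
  rw [memHs_iff_memLp] at *
  refine (memLp_congr_ae ?_).2 (hu.add (hw.const_mul c))
  filter_upwards [fourier_add_smul_ae u w c] with η h
  rw [h, Pi.add_apply]
  ring

/-- The first variation of the `L^(2σ+2)` norm at a boosted ground state vanishes in the directions
whose Fourier transform lives where `|Q̂|` vanishes. -/
theorem IsBoostedGroundState.lintegral_band_eq_zero {p : ℝ → ℝ} {s A v ω : ℝ} {m : ℕ}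
    (hp : SymbolAssumption p s A) (hv : s = 1 / 2 → |v| < A) (hω : -symbolInf p v < ω) {Q : L2}
    (hQ : IsBoostedGroundState p s v ω (m + 1) Q) {B : Set ℝ} (hB : MeasurableSet B) {R : ℝ}
    (hR : B ⊆ Set.Icc (-R) R) (hBQ : ∀ ξ ∈ B, specAbs Q ξ = 0) :
    ∫⁻ ξ, convPow (specAbs Q) (m + 1) ξ *
      ((B.indicator fun _ => (1 : ℝ≥0∞)) ⋆ₗ convPow (specAbs Q) m) ξ = 0 := by
  have hNQ := hQ.integral_norm_pow_eq hp hv hω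
  obtain ⟨hH, h0, hmin⟩ := hQ
  have hs : 1 / 2 ≤ s := hp.2.1
  have hX := lintegral_weight_specAbs_sq_lt_top hs hH
  have hfin : volume B ≠ ∞ := ((measure_mono hR).trans_lt measure_Icc_lt_top).ne
  set φ : ℝ → ℝ≥0∞ := B.indicator fun _ => 1 with hφ
  have hφm : Measurable φ := measurable_const.indicator hB
  set w := bandL2 B hB hfin with hw
  have hwH : MemHs s w := memHs_bandL2 s hB hfin hR
  -- The variation is taken around `Q^•` rather than `Q`: then all transforms are nonnegative and
  -- norms are exactly integrals of convolution powers. Its energy and norm coincide with those of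
  -- `Q`.
  set P := bullet Q with hP
  have hPH : MemHs s P := memHs_bullet hH
  set F := specAbs Q with hF
  have hFm : Measurable F := measurable_specAbs Q
  set T := ∫⁻ ξ, convPow F (m + 1) ξ * (φ ⋆ₗ convPow F m) ξ with hT
  have hFout : ∀ᵐ η, (𝓕 P : L2) η = ((F η).toReal : ℂ) := by
    filter_upwards [fourier_bullet_ae Q] with η h1
    rw [h1, hF, specAbs, toReal_enorm]
  have hU : ∀ ε : ℝ, 0 < ε → ∀ᵐ η, (𝓕 (P + (ε : ℂ) • w) : L2) η =
      (((F η + ENNReal.ofReal ε * φ η).toReal : ℝ) : ℂ) := by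
    intro ε hε
    filter_upwards [hFout, fourier_bandL2 hB hfin, fourier_add_smul_ae P w ε] with η h1 h2 h3
    rw [h3, h1, h2, ENNReal.toReal_add (by simp [hF, specAbs])
      (by by_cases hm : η ∈ B <;> simp [hφ, hm])]
    by_cases hm : η ∈ B <;> simp [hφ, hm, hε.le]
  have hUspec : ∀ ε : ℝ, 0 < ε → specAbs (P + (ε : ℂ) • w) =ᵐ[volume]
      fun η => F η + ENNReal.ofReal ε * φ η := by
    intro ε hε
    filter_upwards [hU ε hε] with η h
    rw [specAbs, h, ← ofReal_norm, Complex.norm_real, Real.norm_of_nonneg ENNReal.toReal_nonneg,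
      ENNReal.ofReal_toReal]
    by_cases hm : η ∈ B <;> simp [hφ, hm, hF, specAbs]
  have hUH : ∀ ε : ℝ, MemHs s (P + (ε : ℂ) • w) := fun ε => memHs_add_smul hPH hwH ε
  have hUX := fun ε : ℝ => lintegral_weight_specAbs_sq_lt_top hs (hUH ε)
  have hlow : ∀ ε : ℝ, 0 < ε → (∫⁻ ξ, convPow F (m + 1) ξ ^ 2) + ENNReal.ofReal ε * (2 * T) ≤
      ∫⁻ ξ, convPow (specAbs (P + (ε : ℂ) • w)) (m + 1) ξ ^ 2 := by
    intro ε hε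
    have hm1 := measurable_convPow hFm (m + 1)
    have hm2 : Measurable (φ ⋆ₗ convPow F m) :=
      measurable_lconvolution _ hφm (measurable_convPow hFm m)
    rw [hT, ← lintegral_const_mul _ (by fun_prop), ← lintegral_const_mul _ (by fun_prop),
      ← lintegral_add_left (by fun_prop)]
    refine lintegral_mono_ae ?_
    filter_upwards [convPow_congr_ae (hUspec ε hε) (m + 1)] with ξ hξ
    rw [hξ]
    exact sq_convPow_add_le F φ hFm _ m ξ
  -- The lower bound at `ε = 1` is already finite.
  have hTfin : T ≠ ∞ := by
    intro hc
    have h1 := (hlow 1 one_pos).trans_lt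
      (lintegral_convPow_sq_lt_top (measurable_specAbs _) (hUX 1) (m + 1))
    simp [hc] at h1
  set E := energyForm p v ω Q with hE
  have hEpos : 0 < E := hp.energyForm_pos hv hω hH h0
  set e := energyForm p v ω w with he
  -- No cross term appears, because `Q̂` vanishes on `B`.
  have hEU : ∀ ε : ℝ, 0 < ε → energyForm p v ω (P + (ε : ℂ) • w) = E + ε ^ 2 * e := by
    intro ε hε
    rw [hE, he, energyForm_eq, energyForm_eq, energyForm_eq, ← integral_const_mul,
      ← integral_add (hp.integrable_energy hv hω hH)
        ((hp.integrable_energy hv hω hwH).const_mul _)]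
    refine integral_congr_ae ?_
    filter_upwards [hU ε hε, fourier_bandL2 hB hfin] with η h1 h2
    rw [h1, h2, Complex.norm_real, Real.norm_of_nonneg ENNReal.toReal_nonneg]
    by_cases hm : η ∈ B
    · have h3 := hBQ η hm
      have h4 : (𝓕 Q : L2) η = 0 := by simpa [hF, specAbs] using h3
      simp [hφ, hm, h3, h4, hε.le]
      ring
    · simp [hφ, hm, hF, specAbs]
  set D := (∫⁻ ξ, convPow F (m + 1) ξ ^ 2).toReal with hD
  have hDpos : 0 < D := by rw [← hNQ]; exact integral_norm_pow_pos hX (m + 1) h0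
  have hDfin := lintegral_convPow_sq_lt_top hFm hX (m + 1)
  have hmain : 2 * T.toReal ≤ 0 := by
    refine nonpos_of_forall_pow_mul_le (E := E) (e := e) (N := D) (k := m + 1 + 1) hEpos
      fun ε hε => ?_
    set U := P + (ε : ℂ) • w with hUdef
    have hNU : ∫ x, ‖U x‖ ^ (2 * (m + 1) + 2) =
        (∫⁻ ξ, convPow (specAbs U) (m + 1) ξ ^ 2).toReal := by
      refine integral_norm_pow_of_nonneg (hUX ε) ?_ (m + 1)
      filter_upwards [hU ε hε, hUspec ε hε] with η h1 h2
      rw [h1, h2]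
    have hNUle : D + ε * (2 * T.toReal) ≤ ∫ x, ‖U x‖ ^ (2 * (m + 1) + 2) := by
      rw [hNU, hD]
      have := ENNReal.toReal_mono
        (lintegral_convPow_sq_lt_top (measurable_specAbs _) (hUX ε) (m + 1)).ne (hlow ε hε)
      rwa [ENNReal.toReal_add hDfin.ne (by finiteness), ENNReal.toReal_mul, ENNReal.toReal_mul,
        ENNReal.toReal_ofReal hε.le, ENNReal.toReal_ofNat] at this
    have hTnn : 0 ≤ T.toReal := ENNReal.toReal_nonneg
    have hUpos : 0 < ∫ x, ‖U x‖ ^ (2 * (m + 1) + 2) := lt_of_lt_of_le (by positivity) hNUle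
    have hU0 : U ≠ 0 := by
      intro hc
      rw [hc] at hUpos
      have : ∫ x, ‖(0 : L2) x‖ ^ (2 * (m + 1) + 2) = 0 := by
        rw [← integral_zero ℝ ℝ]
        refine integral_congr_ae ?_
        filter_upwards [Lp.coeFn_zero ℂ 2 (volume : Measure ℝ)] with x hx
        rw [hx]; simp
      linarith
    have hle : weinstein p v ω (m + 1) Q ≤ weinstein p v ω (m + 1) U := hmin ⟨hUH ε, hU0⟩
    unfold weinstein at hle
    rw [hNQ, hEU ε hε, div_le_div_iff₀ hDpos hUpos] at hle
    have hEk : 0 ≤ E ^ (m + 1 + 1) := by positivity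
    calc E ^ (m + 1 + 1) * (D + ε * (2 * T.toReal))
        ≤ E ^ (m + 1 + 1) * ∫ x, ‖U x‖ ^ (2 * (m + 1) + 2) := by gcongr
      _ ≤ _ := hle
      _ = _ := mul_comm _ _
  have hT0 : T.toReal = 0 := le_antisymm (by linarith) ENNReal.toReal_nonneg
  exact ((ENNReal.toReal_eq_zero_iff _).1 hT0).resolve_right hTfin

/-- The Fourier transform of a boosted ground state vanishes almost nowhere. -/
theorem IsBoostedGroundState.specAbs_ne_zero {p : ℝ → ℝ} {s A v ω : ℝ} {σ : ℕ} (hσ : 0 < σ)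
    (hp : SymbolAssumption p s A) (hv : s = 1 / 2 → |v| < A) (hω : -symbolInf p v < ω) {Q : L2}
    (hQ : IsBoostedGroundState p s v ω σ Q) : ∀ᵐ ξ, specAbs Q ξ ≠ 0 := by
  obtain ⟨m, rfl⟩ : ∃ m, σ = m + 1 := ⟨σ - 1, by omega⟩
  have hFm := measurable_specAbs Q
  have hhm := measurable_convPow hFm m
  have hFne : ∫⁻ x, specAbs Q x ≠ 0 := by
    intro hc
    rw [lintegral_eq_zero_iff hFm] at hc
    refine volume_specAbs_ne_zero hQ.2.1 ?_
    have : ∀ᵐ ξ, specAbs Q ξ = 0 := hc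
    rwa [ae_iff] at this
  refine ae_mem_of_ae_translate (Ω := {ξ | specAbs Q ξ ≠ 0})
    (H := {ξ | convPow (specAbs Q) m ξ ≠ 0})
    (hFm (measurableSet_singleton 0)).compl (hhm (measurableSet_singleton 0)).compl
    (volume_specAbs_ne_zero hQ.2.1) ?_ ?_
  · intro hc
    refine lintegral_convPow_ne_zero hFm hFne m ?_
    rw [lintegral_eq_zero_iff hhm]
    have : ∀ᵐ ξ, convPow (specAbs Q) m ξ = 0 := by rw [ae_iff]; exact hc
    exact this
  -- The zero set is cut off to `[-n, n]` so that its indicator is the transform of an `H^s`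
  -- function; the countable union over `n` recovers it.
  · have key : ∀ n : ℕ, ∀ᵐ τ, ∀ᵐ ζ, convPow (specAbs Q) m τ ≠ 0 → convPow (specAbs Q) m ζ ≠ 0 →
        ∀ᵐ η, specAbs Q η = 0 → |η| ≤ n → specAbs Q (η - (τ - ζ)) = 0 := by
      intro n
      set B : Set ℝ := {η | specAbs Q η = 0} ∩ Set.Icc (-(n : ℝ)) n with hB
      have hBm : MeasurableSet B := (hFm (measurableSet_singleton 0)).inter measurableSet_Icc
      have := ae_of_lintegral_lconvolution_mul_eq_zero hFm (measurable_const.indicator hBm) hhm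
        (hQ.lintegral_band_eq_zero hp hv hω hBm Set.inter_subset_right fun ξ hξ => hξ.1)
      filter_upwards [this] with τ h1
      filter_upwards [h1] with ζ h2 h3 h4
      filter_upwards [h2 h3 h4] with η h5 h6 h7
      refine h5 ?_
      have : η ∈ B := ⟨h6, abs_le.1 h7⟩
      simp [this]
    filter_upwards [ae_all_iff.2 key] with τ h1
    filter_upwards [ae_all_iff.2 h1] with ζ h2 h3 h4
    filter_upwards [ae_all_iff.2 fun n => h2 n h3 h4] with η h5 h6
    obtain ⟨n, hn⟩ := exists_nat_ge |η|
    have h7 : specAbs Q η = 0 := not_not.1 h6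
    exact not_not.2 (h5 n h7 hn)

/-! ### Rigidity: from equality of moduli to an affine phase. -/

/-- Descent of equality in `‖û * ĝ‖ ≤ |û| * |ĝ|`, for almost nowhere vanishing `û`. -/
theorem specAbs_eq_of_specAbs_succ_eq {u V V' : L2} {n : ℕ}
    (hu : ∫⁻ x, weight 1 x * specAbs u x ^ 2 < ∞) (hpos : ∀ᵐ ξ, specAbs u ξ ≠ 0)
    (hV : V =ᵐ[volume] fun x => u x ^ (n + 1)) (hV' : V' =ᵐ[volume] fun x => u x ^ (n + 2))
    (hle : specAbs V ≤ᵐ[volume] convPow (specAbs u) n)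
    (heq : specAbs V' =ᵐ[volume] convPow (specAbs u) (n + 1)) :
    specAbs V =ᵐ[volume] convPow (specAbs u) n := by
  have hF := fourier_pow_succ hV hV' (lintegral_lconvolution_sq_lt_top hu hle)
  -- A single frequency `ξ` suffices: equality of the integrals over `η` forces equality of the
  -- integrands, and `û ≠ 0` may be cancelled for almost every `η`.
  obtain ⟨ξ, h1, h2⟩ := (heq.and hF).exists
  have hum := measurable_specAbs u
  have hVm := measurable_specAbs V
  have hcm := measurable_convPow hum n
  have hle' : ∀ᵐ η, specAbs u η * specAbs V (ξ - η) ≤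
      specAbs u η * convPow (specAbs u) n (ξ - η) := by
    filter_upwards [(quasi_sub ξ).ae hle] with η hη
    gcongr
  have e1 : convPow (specAbs u) (n + 1) ξ = ∫⁻ η, specAbs u η * convPow (specAbs u) n (ξ - η) := by
    rw [convPow, lconvolution_def]; simp only [neg_add_eq_sub]
  have hup : ∫⁻ η, specAbs u η * convPow (specAbs u) n (ξ - η) ≤
      ∫⁻ η, specAbs u η * specAbs V (ξ - η) := by
    rw [← e1, ← h1, specAbs, h2]
    refine (enorm_integral_mul_sub_le u V ξ).trans (le_of_eq ?_)
    rw [lconvolution_def]; simp only [neg_add_eq_sub]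
  have hfin : ∫⁻ η, specAbs u η * specAbs V (ξ - η) ≠ ∞ := by
    refine ((lintegral_mono_ae hle').trans_lt ?_).ne
    rw [← e1, ← h1]
    simp [specAbs]
  have := ae_eq_of_ae_le_of_lintegral_le hle' hfin (by fun_prop) hup
  have h3 : ∀ᵐ η, specAbs V (ξ - η) = convPow (specAbs u) n (ξ - η) := by
    filter_upwards [this, hpos] with η h4 h5
    exact (ENNReal.mul_right_inj h5 (by simp [specAbs])).1 h4
  have h6 := (quasi_sub ξ).ae h3
  simp only [sub_sub_cancel] at h6
  exact h6

/-- Equal `L²` norms together with the pointwise bound give equality almost everywhere for the power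
`n + 1`; it then descends one power at a time to the square. -/
theorem exists_pow_L2_specAbs_eq {u : L2} (hu : ∫⁻ x, weight 1 x * specAbs u x ^ 2 < ∞)
    (hpos : ∀ᵐ ξ, specAbs u ξ ≠ 0) {n : ℕ} (hn : 0 < n)
    (hN : ∫ x, ‖u x‖ ^ (2 * n + 2) = (∫⁻ ξ, convPow (specAbs u) n ξ ^ 2).toReal) :
    ∃ V : L2, (V =ᵐ[volume] fun x => u x ^ 2) ∧ specAbs V =ᵐ[volume] convPow (specAbs u) 1 := by
  choose V hV hle using exists_pow_L2 hu
  have htop : specAbs (V n) =ᵐ[volume] convPow (specAbs u) n := by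
    rw [integral_norm_pow_eq (hV n)] at hN
    have hfin := lintegral_convPow_sq_lt_top (measurable_specAbs u) hu n
    have hle2 : ∀ᵐ ξ, specAbs (V n) ξ ^ 2 ≤ convPow (specAbs u) n ξ ^ 2 := by
      filter_upwards [hle n] with ξ h
      gcongr
    have hVfin : ∫⁻ ξ, specAbs (V n) ξ ^ 2 ≠ ∞ := ((lintegral_mono_ae hle2).trans_lt hfin).ne
    have heq := (ENNReal.toReal_eq_toReal_iff' hVfin hfin.ne).1 hN
    filter_upwards [ae_eq_of_ae_le_of_lintegral_le hle2 hVfin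
      ((measurable_convPow (measurable_specAbs u) n).pow_const 2).aemeasurable heq.ge] with ξ h
    exact (ENNReal.pow_right_strictMono two_ne_zero).injective h
  have hdesc : ∀ j, j + 1 ≤ n → specAbs (V (n - j)) =ᵐ[volume] convPow (specAbs u) (n - j) := by
    intro j
    induction j with
    | zero => intro _; exact htop
    | succ j ih =>
      intro hj
      obtain ⟨i, hi⟩ : ∃ i, n - (j + 1) = i := ⟨_, rfl⟩
      have h1 := ih (by omega)
      rw [show n - j = i + 1 by omega] at h1
      rw [hi]
      exact specAbs_eq_of_specAbs_succ_eq hu hpos (hV i) (hV (i + 1)) (hle i) h1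
  have h1 := hdesc (n - 1) (by omega)
  rw [show n - (n - 1) = 1 by omega] at h1
  exact ⟨V 1, hV 1, h1⟩

/-- The case of equality in the triangle inequality for integrals. -/
theorem ae_eq_norm_mul_of_norm_integral_eq {z : ℝ → ℂ} (hz : Integrable z)
    (h : ‖∫ x, z x‖ = ∫ x, ‖z x‖) :
    ∀ᵐ x, z x * ((‖∫ x, z x‖ : ℝ) : ℂ) = ((‖z x‖ : ℝ) : ℂ) * ∫ x, z x := by
  set g := ∫ x, z x with hg
  rcases eq_or_ne g 0 with h0 | h0
  · rw [h0]; simp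
  have hgn : 0 < ‖g‖ := norm_pos_iff.2 h0
  -- `c` is the unimodular factor rotating the integral onto the positive axis; equality forces
  -- every `c * z x` onto that axis as well.
  set c : ℂ := (starRingEnd ℂ) g / (‖g‖ : ℝ) with hc
  have hcn : ‖c‖ = 1 := by
    rw [hc, norm_div, RCLike.norm_conj, Complex.norm_real, norm_norm, div_self hgn.ne']
  have hcg : c * g = ((‖g‖ : ℝ) : ℂ) := by
    rw [hc, div_mul_eq_mul_div, mul_comm, Complex.mul_conj, Complex.normSq_eq_norm_sq]
    have : ((‖g‖ : ℝ) : ℂ) ≠ 0 := by exact_mod_cast hgn.ne'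
    push_cast
    field_simp
  have hle : ∀ x, (c * z x).re ≤ ‖z x‖ := fun x => by
    refine (Complex.re_le_norm _).trans ?_
    rw [norm_mul, hcn, one_mul]
  have hint : ∫ x, (‖z x‖ - (c * z x).re) = 0 := by
    have hci : Integrable fun x => c * z x := hz.const_mul c
    have hre : ∫ x, (c * z x).re = (∫ x, c * z x).re := integral_re hci
    have hci' : Integrable fun x => (c * z x).re := hci.re
    rw [integral_sub hz.norm hci', ← h, hre, integral_const_mul, ← hg, hcg,
      Complex.ofReal_re, sub_self]
  have hae := (integral_eq_zero_iff_of_nonneg (fun x => sub_nonneg.2 (hle x))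
    (hz.norm.sub (hz.const_mul c).re)).1 hint
  filter_upwards [hae] with x hx
  simp only [Pi.zero_apply, sub_eq_zero] at hx
  have hn : ‖c * z x‖ = ‖z x‖ := by rw [norm_mul, hcn, one_mul]
  have h1 : c * z x = ((‖z x‖ : ℝ) : ℂ) := by
    rw [← hn]
    have : ‖c * z x‖ = (c * z x).re := by rw [hn, hx]
    exact (Complex.eq_coe_norm_of_nonneg (Complex.re_eq_norm.1 this.symm))
  rw [← hcg, ← h1]; ring

/-- If `|û * û| = |û| * |û|` almost everywhere and `û` vanishes almost nowhere, then the phase of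
`û` is affine. -/
theorem exists_phase_of_specAbs_sq_eq {u V : L2} (hV : V =ᵐ[volume] fun x => u x ^ 2)
    (hu : ∫⁻ x, weight 1 x * specAbs u x ^ 2 < ∞) (hpos : ∀ᵐ ξ, specAbs u ξ ≠ 0)
    (heq : specAbs V =ᵐ[volume] convPow (specAbs u) 1) :
    ∃ a b : ℝ, ∀ᵐ ξ, (𝓕 u : L2) ξ = Complex.exp (a * Complex.I) *
      Complex.exp (b * ξ * Complex.I) * ((‖(𝓕 u : L2) ξ‖ : ℝ) : ℂ) := by
  have hF := fourier_pow_succ (u := u) (V := u) (V' := V) (n := 0) (by simp) hV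
    (lintegral_lconvolution_sq_lt_top (n := 0) hu Filter.EventuallyLE.rfl)
  have hm := measurable_L2 (𝓕 u)
  have hmV := measurable_L2 (𝓕 V)
  -- The value 1 on the null set of zeros makes `θ` unimodular everywhere, as
  -- `exists_exp_of_ae_mul_eq` requires.
  set θ : ℝ → ℂ := fun ξ =>
    if (𝓕 u : L2) ξ = 0 then 1 else (𝓕 u : L2) ξ / ((‖(𝓕 u : L2) ξ‖ : ℝ) : ℂ)
    with hθ
  set Θ : ℝ → ℂ := fun ξ => (𝓕 V : L2) ξ / ((‖(𝓕 V : L2) ξ‖ : ℝ) : ℂ) with hΘ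
  have hθm : Measurable θ := by
    refine Measurable.ite (hm (measurableSet_singleton 0)) measurable_const ?_
    fun_prop
  have hΘm : Measurable Θ := by fun_prop
  have hθ1 : ∀ ξ, ‖θ ξ‖ = 1 := by
    intro ξ
    simp only [hθ]
    split_ifs with h
    · simp
    · rw [norm_div, Complex.norm_real, norm_norm, div_self (norm_ne_zero_iff.2 h)]
  have hupos : ∀ᵐ ξ, (𝓕 u : L2) ξ ≠ 0 := by
    filter_upwards [hpos] with ξ h
    simpa [specAbs] using h
  have key : ∀ᵐ ξ, ∀ᵐ η, θ η * θ (ξ - η) = Θ ξ := by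
    filter_upwards [hF, heq] with ξ h1 h2
    have hint := integrable_mul_sub ξ (𝓕 u) (𝓕 u)
    have hnorm : ‖∫ η : ℝ, (𝓕 u : L2) η * (𝓕 u : L2) (ξ - η)‖ =
        ∫ η : ℝ, ‖(𝓕 u : L2) η * (𝓕 u : L2) (ξ - η)‖ := by
      rw [integral_norm_eq_lintegral_enorm hint.aestronglyMeasurable, ← h1, ← toReal_enorm]
      congr 1
      refine h2.trans ?_
      rw [convPow, lconvolution_def]
      refine lintegral_congr fun η => ?_
      rw [enorm_mul, neg_add_eq_sub]; rfl
    have hpos' := (quasi_sub ξ).ae hupos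
    have hVne : (𝓕 V : L2) ξ ≠ 0 := by
      rw [h1, ← norm_ne_zero_iff, hnorm]
      intro hc
      rw [integral_eq_zero_iff_of_nonneg (fun _ => norm_nonneg _) hint.norm] at hc
      obtain ⟨η, h3, h4, h5⟩ := (hc.and (hupos.and hpos')).exists
      simp [h4, h5] at h3
    filter_upwards [ae_eq_norm_mul_of_norm_integral_eq hint hnorm, hupos, hpos'] with η h3 h4 h5
    rw [← h1, norm_mul] at h3
    have n1 : ((‖(𝓕 u : L2) η‖ : ℝ) : ℂ) ≠ 0 := by exact_mod_cast norm_ne_zero_iff.2 h4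
    have n2 : ((‖(𝓕 u : L2) (ξ - η)‖ : ℝ) : ℂ) ≠ 0 := by exact_mod_cast norm_ne_zero_iff.2 h5
    have n3 : ((‖(𝓕 V : L2) ξ‖ : ℝ) : ℂ) ≠ 0 := by exact_mod_cast norm_ne_zero_iff.2 hVne
    simp only [hθ, hΘ, h4, h5, if_false]
    push_cast at h3
    field_simp
    linear_combination h3
  have hset : MeasurableSet {q : ℝ × ℝ | θ q.2 * θ (q.1 - q.2) = Θ q.1} :=
    measurableSet_eq_fun (by fun_prop) (by fun_prop)
  -- The relation holds for almost every sum `ξ`; exchanging quantifiers fixes a summand first,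
  -- after which `ξ = x + y` turns it into the Cauchy equation.
  have key2 := (Measure.ae_ae_comm (μ := volume) (ν := volume)
    (p := fun ξ η : ℝ => θ η * θ (ξ - η) = Θ ξ) hset).1 key
  have key3 : ∀ᵐ x, ∀ᵐ y, θ x * θ y = Θ (x + y) := by
    filter_upwards [key2] with x hx
    have := (measurePreserving_add_left volume x).quasiMeasurePreserving.ae hx
    simpa only [add_sub_cancel_left] using this
  obtain ⟨a, b, hab⟩ := exists_exp_of_ae_mul_eq hθm hθ1 key3
  refine ⟨a, b, ?_⟩
  filter_upwards [hab, hupos] with ξ h1 h2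
  have n1 : ((‖(𝓕 u : L2) ξ‖ : ℝ) : ℂ) ≠ 0 := by exact_mod_cast norm_ne_zero_iff.2 h2
  rw [← h1]
  simp only [hθ, h2, if_false]
  field_simp

/-! ### Phase, translation and the conclusion. -/

theorem phaseTranslate_eq (θ y : ℝ) (u : L2) :
    phaseTranslate θ y u = Complex.exp (θ * Complex.I) • translate y u := rfl

theorem phaseTranslate_ae (θ y : ℝ) (u : L2) :
    phaseTranslate θ y u =ᵐ[volume] fun x => Complex.exp (θ * Complex.I) * u (x + y) := by
  rw [phaseTranslate_eq]
  filter_upwards [Lp.coeFn_smul (Complex.exp (θ * Complex.I)) (translate y u), translate_ae y u]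
    with x h1 h2
  rw [h1, Pi.smul_apply, h2, smul_eq_mul]

theorem fourier_phaseTranslate (θ y : ℝ) (u : L2) :
    (𝓕 (phaseTranslate θ y u) : L2) =ᵐ[volume] fun η => Complex.exp (θ * Complex.I) *
      (Complex.exp (2 * Real.pi * (y * η) * Complex.I) * (𝓕 u : L2) η) := by
  rw [phaseTranslate_eq, FourierTransform.fourier_smul]
  filter_upwards [Lp.coeFn_smul (Complex.exp (θ * Complex.I)) (𝓕 (translate y u) : L2),
    fourier_translate y u] with x h1 h2
  rw [h1, Pi.smul_apply, h2, smul_eq_mul]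

theorem ext_fourier {u w : L2} (h : (𝓕 u : L2) =ᵐ[volume] (𝓕 w : L2)) : u = w :=
  (Lp.fourierTransformₗᵢ ℝ ℂ).injective (Lp.ext h)

theorem phaseTranslate_neg_phaseTranslate (θ y : ℝ) (u : L2) :
    phaseTranslate (-θ) (-y) (phaseTranslate θ y u) = u := by
  refine ext_fourier ?_
  filter_upwards [fourier_phaseTranslate (-θ) (-y) (phaseTranslate θ y u),
    fourier_phaseTranslate θ y u] with η h1 h2
  rw [h1, h2]
  simp only [← mul_assoc, ← Complex.exp_add]
  rw [show ((-θ : ℝ) : ℂ) * Complex.I + (2 * Real.pi * ((-y : ℝ) : ℂ) * η * Complex.I +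
    (θ * Complex.I + 2 * Real.pi * y * η * Complex.I)) = 0 by push_cast; ring, Complex.exp_zero,
    one_mul]

/-- On the Fourier side conjugate reflection is complex conjugation, and the transform of `u^•` is
real. -/
theorem conjNeg_bullet (u : L2) : conjNeg (bullet u) = bullet u := by
  refine ext_fourier ?_
  rw [fourier_conjNeg]
  filter_upwards [Lp.coeFn_star (𝓕 (bullet u) : L2), fourier_bullet_ae u] with η h1 h2
  rw [h1, Pi.star_apply, h2]
  simp

/-- A boosted ground state is `Q^•` up to phase and translation. -/
theorem IsBoostedGroundState.exists_eq_phaseTranslate_bullet {p : ℝ → ℝ} {s A v ω : ℝ} {σ : ℕ}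
    (hp : SymbolAssumption p s A) (hv : s = 1 / 2 → |v| < A) (hσ : 0 < σ)
    (hω : -symbolInf p v < ω) {Q : L2} (hQ : IsBoostedGroundState p s v ω σ Q) :
    ∃ α x₀ : ℝ, Q = phaseTranslate α x₀ (bullet Q) := by
  have hX := lintegral_weight_specAbs_sq_lt_top hp.2.1 hQ.1
  have hpos := hQ.specAbs_ne_zero hσ hp hv hω
  obtain ⟨V, hV, hVeq⟩ := exists_pow_L2_specAbs_eq hX hpos hσ (hQ.integral_norm_pow_eq hp hv hω)
  obtain ⟨a, b, hab⟩ := exists_phase_of_specAbs_sq_eq hV hX hpos hVeq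
  -- Translation by `y` multiplies `𝓕` by `e^(2πiyη)`, so the slope `b` corresponds to `y = b /
  -- (2π)`.
  refine ⟨a, b / (2 * Real.pi), ext_fourier ?_⟩
  filter_upwards [hab, fourier_phaseTranslate a (b / (2 * Real.pi)) (bullet Q),
    fourier_bullet_ae Q] with η h1 h2 h3
  rw [h2, h3, h1, norm_mul, norm_mul, Complex.norm_exp_ofReal_mul_I, ← Complex.ofReal_mul,
    Complex.norm_exp_ofReal_mul_I, Complex.norm_real, norm_norm, one_mul, one_mul, mul_assoc]
  congr 3
  have : (Real.pi : ℂ) ≠ 0 := by exact_mod_cast Real.pi_ne_zero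
  push_cast
  field_simp

end BoostedNLS

theorem theorem3 (p : ℝ → ℝ) (s A v ω : ℝ) (σ : ℕ)
    (hp : BoostedNLS.SymbolAssumption p s A)
    (hv : s = 1 / 2 → |v| < A)
    (hσ : 0 < σ)
    (hω : -BoostedNLS.symbolInf p v < ω)
    (Q : BoostedNLS.L2)
    (hQ : BoostedNLS.IsBoostedGroundState p s v ω σ Q) :
    ∃ α x₀ : ℝ,
      (∀ᵐ x : ℝ, Q x = Complex.exp (α * Complex.I) * BoostedNLS.bullet Q (x + x₀)) ∧
      (∀ᵐ ξ : ℝ, BoostedNLS.fourierHat (BoostedNLS.phaseTranslate (-α) (-x₀) Q) ξ =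
        ((‖BoostedNLS.fourierHat (BoostedNLS.phaseTranslate (-α) (-x₀) Q) ξ‖ : ℝ) : ℂ)) ∧
      (∀ᵐ x : ℝ, BoostedNLS.phaseTranslate (-α) (-x₀) Q x =
        (starRingEnd ℂ) (BoostedNLS.phaseTranslate (-α) (-x₀) Q (-x))) := by
  obtain ⟨α, x₀, h⟩ := hQ.exists_eq_phaseTranslate_bullet hp hv hσ hω
  have hinv : BoostedNLS.phaseTranslate (-α) (-x₀) Q = BoostedNLS.bullet Q := by
    conv_lhs => rw [h]
    exact BoostedNLS.phaseTranslate_neg_phaseTranslate α x₀ _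
  refine ⟨α, x₀, ?_, ?_, ?_⟩
  · have ht := BoostedNLS.phaseTranslate_ae α x₀ (BoostedNLS.bullet Q)
    rwa [← h] at ht
  · rw [hinv]
    filter_upwards [BoostedNLS.fourierHat_bullet Q] with ξ hξ
    rw [hξ, Complex.norm_real, norm_norm]
  · rw [hinv]
    have hc := BoostedNLS.conjNeg_ae (BoostedNLS.bullet Q)
    rwa [BoostedNLS.conjNeg_bullet] at hc
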